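/- \textbf{Setting.} A cluster has $N=3f+1$ processes $p_0,\dots,p_{3f}$, at most $f$ of them Byzantine; the others are correct. Byzantine processes send arbitrary messages in their own names, but cannot forge signatures or messages of correct processes. The network is partially synchronous: links are authenticated and perfect, and a message sent at time $s$ between correct processes arrives by time $\max(s,\mathrm{GST})+\delta$, where $\delta>0$ and $\mathrm{GST}$ is an arbitrary global stabilization time. Local computation takes no time. A message whose handler has a guard is buffered until the guard holds; "broadcast" sends to all processes, including oneself. The timer under leader timestamp $t$ has period $\Delta(t)>0$ (for instance constant or increasing), and $\Delta(t)>6\delta$ for all sufficiently large $t$. \textbf{Byzantine Reliable Dissemination (BRD).} Every process keeps a current leader with timestamp $\mathit{ts}$, initially an arbitrary process (possibly Byzantine) with $\mathit{ts}=0$, and a timer, running from the start with period $\Delta(0)$. (1) On request $\mathit{broadcast}(m)$ (at most one per process) it stores $m$, sends the signed $\langle m,\mathit{ts}\rangle$ to the leader and resets its timer. (2) The leader collects the senders, messages and signatures of the messages $\langle m,\mathit{ts}\rangle$ of its current timestamp, and the messages $\mathit{Valid}(M,\Sigma,t)$ that it consumes while it is the leader and whose $\Sigma$ holds $2f+1$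 signatures of $\mathit{Echo}(M,t)$ or $f+1$ of $\mathit{Ready}(M,t)$, keeping a set $M$ of largest $t$. When it has heard from $2f+1$ processes, it broadcasts, once per timestamp, $\mathit{Agg}(M,\Sigma,\mathit{ts})$, with the kept valid set and its certificate if there is one, and otherwise with the collected messages and signatures. (3) On the first $\mathit{Agg}(M,\Sigma,\mathit{ts})$ from the leader in which $\Sigma$ attests $M$ ($M$ is the set of messages signed in $\Sigma$ for $\mathit{ts}$, with at least $2f+1$ signers; or, for some timestamp $u$, $\Sigma$ holds $2f+1$ signatures of $\mathit{Echo}(M,u)$ or $f+1$ of $\mathit{Ready}(M,u)$), a process broadcasts the signed $\mathit{Echo}(M,\mathit{ts})$. (4) On $2f+1$ messages $\mathit{Echo}(M,\mathit{ts})$ or $f+1$ messages $\mathit{Ready}(M,\mathit{ts})$ from distinct processes, it broadcasts the signed $\mathit{Ready}(M,\mathit{ts})$, once per timestamp, and stores $M$ with these signatures and $\mathit{ts}$ as its valid set. (5) On $2f+1$ messages $\mathit{Ready}(M,\mathit{ts})$ from distinct processes, it delivers $M$, unless it has delivered before, and stops its timer. (6) When the timer expires, it complains to leader election. (7) On $\mathit{new\text{-}leader}(p,t)$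 it sets its leader to $p$ and $\mathit{ts}=t$, clears the state of the old timestamp except the valid set, the broadcast message and the fact that it delivered, resets its timer, and sends to $p$ its valid set, if there is one, and otherwise $\langle m,t\rangle$ for the message $m$ that it broadcast, if any. \textbf{Leader election.} Every process has an election timestamp, initially $1$. A complaint makes it broadcast $\mathit{Complaint}(t)$ for its election timestamp $t$, once per timestamp; $f+1$ messages $\mathit{Complaint}(t)$ from distinct processes make it do the same; after $2f+1$ of them it moves to timestamp $t+1$ and issues $\mathit{new\text{-}leader}(p_{(t+1)\bmod N},t+1)$ to BRD. \textbf{Lemma (Termination).} In every infinite execution (with time unbounded) of BRD composed with this leader election, if every correct process broadcasts a message, then every correct process eventually delivers a set of messages, whichever processes are Byzantine, the initial leader included. -/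

import Mathlib

/-!
Byzantine Reliable Dissemination (BRD) in one cluster of `3 f + 1` processes, composed with the
complaint-based leader election, over authenticated perfect links in a partially synchronous network.
An event `upon deliver(..) where G` whose guard `G` is false when the message arrives stays buffered
until `G` holds.
-/

namespace BRD

/-- The processes `p_0, ..., p_{3 f}` of the cluster. -/
abbrev Proc (f : ℕ) : Type := Fin (3 * f + 1)

/-- The protocol messages whose signatures are used in certificates:
`⟨m, t⟩`, `Echo(M, t)` and `Ready(M, t)`. -/
inductive Stmt (V : Type*) where
  | contrib (m : V) (t : ℕ)
  | echo (M : Finset V) (t : ℕ)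
  | ready (M : Finset V) (t : ℕ)

/-- A signature: the signing process together with what it signed. -/
abbrev Sig (f : ℕ) (V : Type*) := Proc f × Stmt V

/-- Messages on the links: a signed statement (the signature is that of the sender),
`Agg(M, Σ, t)`, `Valid(M, Σ, t)`, and the leader election message `Complaint(t)`. -/
inductive Msg (f : ℕ) (V : Type*) where
  | signed (x : Stmt V)
  | agg (M : Finset V) (sigs : Finset (Sig f V)) (t : ℕ)
  | valid (M : Finset V) (sigs : Finset (Sig f V)) (t : ℕ)
  | complaint (t : ℕ)

/-- The signatures of certificates carried inside a message. -/
def Msg.carried {f : ℕ} {V : Type*} : Msg f V → Finset (Sig f V)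
  | .signed _ => ∅
  | .agg _ sigs _ => sigs
  | .valid _ sigs _ => sigs
  | .complaint _ => ∅

/-- A message in transit. `id` is the number of the step that sent it; it distinguishes
equal messages that are sent at different moments. -/
structure Packet (f : ℕ) (V : Type*) where
  id : ℕ
  src : Proc f
  dst : Proc f
  msg : Msg f V

/-- What a handler sends: destinations with messages. -/
abbrev Out (f : ℕ) (V : Type*) := Set (Proc f × Msg f V)

/-- Best-effort broadcast: the message goes to every process, the sender included. -/
def toAll {f : ℕ} {V : Type*} (x : Msg f V) : Out f V := {o | o.2 = x}

open Classical in
/-- The number of distinct processes whose signature of `x` is in `sigs`. -/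
noncomputable def sigCount {f : ℕ} {V : Type*} (sigs : Finset (Sig f V)) (x : Stmt V) : ℕ :=
  (Finset.univ.filter fun p : Proc f => (p, x) ∈ sigs).card

/-- `sigs` holds `2 f + 1` signatures of `Echo(M, t)` or `f + 1` signatures of `Ready(M, t)`. -/
def VoteCert {f : ℕ} {V : Type*} (M : Finset V) (sigs : Finset (Sig f V)) (t : ℕ) : Prop :=
  2 * f + 1 ≤ sigCount sigs (.echo M t) ∨ f + 1 ≤ sigCount sigs (.ready M t)

open Classical in
/-- `M` is the set of the messages signed in `sigs` for timestamp `t`, and at least `2 f + 1`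
processes signed one. -/
def CollectCert {f : ℕ} {V : Type*} (M : Finset V) (sigs : Finset (Sig f V)) (t : ℕ) : Prop :=
  2 * f + 1 ≤ (Finset.univ.filter fun p : Proc f => ∃ m, (p, Stmt.contrib m t) ∈ sigs).card ∧
    ∀ m, m ∈ M ↔ ∃ p : Proc f, (p, Stmt.contrib m t) ∈ sigs

/-- The check on `Agg(M, Σ, t)`: `Σ` attests `M`, either by collected messages of the current
timestamp, or by the votes of some timestamp (for an adopted set, an earlier one). -/
def Attests {f : ℕ} {V : Type*} (M : Finset V) (sigs : Finset (Sig f V)) (t : ℕ) : Prop :=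
  CollectCert M sigs t ∨ ∃ u, VoteCert M sigs u

/-- The local state of a process: BRD variables, leader election variables, and link buffers. -/
structure LState (f : ℕ) (V : Type*) where
  leader : Proc f
  ts : ℕ
  /-- the message the process broadcast, if any -/
  myM : Option V
  echoed : Prop
  readied : Prop
  delivered : Prop
  valid : Option (Finset V × Finset (Sig f V) × ℕ)
  highValid : Option (Finset V × Finset (Sig f V) × ℕ)
  /-- as leader: senders, messages and signatures collected for the current timestamp -/
  q : Finset (Proc f)
  M : Finset V
  sigs : Finset (Sig f V)
  /-- as leader: whether the aggregation was broadcast for the current timestamp -/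
  proposed : Prop
  /-- when the timer expires; `none` if it is stopped or has expired -/
  deadline : Option ℝ
  /-- the response `deliver(M, Σ)` with certificate `Σ'`, once it is issued -/
  output : Option (Finset V × Finset (Sig f V) × Finset (Sig f V))
  /-- leader election: timestamp, complaining processes, whether the process complained -/
  leTs : ℕ
  leC : Finset (Proc f)
  leComplained : Prop
  /-- packets delivered by the links, and those of them consumed by a handler -/
  received : Set (Packet f V)
  handled : Set (Packet f V)

/-- The state at time `0`. `timeout t` is the period of the timer under timestamp `t`. -/
def LState.init {f : ℕ} (V : Type*) (timeout : ℕ → ℝ) (p₀ : Proc f) : LState f V where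
  leader := p₀
  ts := 0
  myM := none
  echoed := False
  readied := False
  delivered := False
  valid := none
  highValid := none
  q := ∅
  M := ∅
  sigs := ∅
  proposed := False
  deadline := some (timeout 0)
  output := none
  leTs := 1
  leC := ∅
  leComplained := False
  received := ∅
  handled := ∅

namespace LState

variable {f : ℕ} {V : Type*}

open Classical in
/-- The processes from which the statement `x` was received. -/
noncomputable def senders (s : LState f V) (x : Stmt V) : Finset (Proc f) :=
  Finset.univ.filter fun p => ∃ k ∈ s.received, k.src = p ∧ k.msg = .signed x

/-- The signatures of `x` that were received. -/
noncomputable def cert (s : LState f V) (x : Stmt V) : Finset (Sig f V) :=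
  s.senders x ×ˢ {x}

/-- The packet `k` was received and is not consumed yet. -/
def Pending (s : LState f V) (k : Packet f V) : Prop := k ∈ s.received ∧ k ∉ s.handled

/-- Consume the packet `k`. -/
def consume (s : LState f V) (k : Packet f V) : LState f V :=
  { s with handled := insert k s.handled }

open Classical in
/-- The leader adds a message `m` of `p` to its collection. -/
noncomputable def collect (s : LState f V) (p : Proc f) (m : V) : LState f V :=
  { s with
    q := insert p s.q
    M := insert m s.M
    sigs := insert (p, Stmt.contrib m s.ts) s.sigs }

open Classical in
/-- The leader handles an attested valid set of `p`, keeping the one of largest timestamp. -/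
noncomputable def collectValid (s : LState f V) (p : Proc f) (v : Finset V × Finset (Sig f V) × ℕ) :
    LState f V :=
  { s with
    q := insert p s.q
    highValid :=
      match s.highValid with
      | none => some v
      | some w => if w.2.2 < v.2.2 then some v else some w }

/-- The aggregation that the leader broadcasts: the adopted valid set if there is one, and
otherwise the collected messages. -/
def proposal (s : LState f V) : Msg f V :=
  match s.highValid with
  | none => .agg s.M s.sigs s.ts
  | some v => .agg v.1 v.2.1 s.ts

/-- The BRD request `new-leader(p, t)` at time `now`: the new state. -/
def newLeader (timeout : ℕ → ℝ) (now : ℝ) (s : LState f V) (p : Proc f) (t : ℕ) : LState f V :=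
  { s with
    leader := p
    ts := t
    echoed := False
    readied := False
    highValid := none
    q := ∅
    M := ∅
    sigs := ∅
    proposed := False
    deadline := some (now + timeout t) }

/-- The BRD request `new-leader(p, t)`: what is sent to the new leader. -/
def newLeaderOut (s : LState f V) (p : Proc f) (t : ℕ) : Out f V :=
  match s.valid with
  | some v => {(p, .valid v.1 v.2.1 v.2.2)}
  | none =>
    match s.myM with
    | some m => {(p, .signed (.contrib m t))}
    | none => ∅

open Classical in
/-- The leader election request `complain`: broadcast a complaint unless this was done already. -/
noncomputable def complain (s : LState f V) : LState f V × Out f V :=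
  if s.leComplained then (s, ∅) else ({ s with leComplained := True }, toAll (.complaint s.leTs))

/-- Leader election moves to the next leader in round-robin order, `p_{ts mod (3 f + 1)}`,
and passes it to BRD. -/
def change (timeout : ℕ → ℝ) (now : ℝ) (s : LState f V) : LState f V × Out f V :=
  let t := s.leTs + 1
  let p : Proc f := Fin.ofNat (3 * f + 1) t
  (newLeader timeout now { s with leTs := t, leC := ∅, leComplained := False } p t,
    s.newLeaderOut p t)

open Classical in
/-- Leader election handles a complaint of `p` for its current timestamp: amplify after `f + 1`
complaints, change the leader after `2 f + 1`. -/
noncomputable def onComplaint (timeout : ℕ → ℝ) (now : ℝ) (s : LState f V) (p : Proc f) :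
    LState f V × Out f V :=
  let s₁ : LState f V := { s with leC := insert p s.leC }
  let r₂ : LState f V × Out f V := if f + 1 ≤ s₁.leC.card then s₁.complain else (s₁, ∅)
  if 2 * f + 1 ≤ s₁.leC.card then
    ((change timeout now r₂.1).1, r₂.2 ∪ (change timeout now r₂.1).2)
  else r₂

end LState

/-- The events at a correct process. -/
inductive Event (f : ℕ) (V : Type*) where
  /-- request `broadcast(m)` -/
  | broadcast (m : V)
  /-- the link hands over a packet -/
  | receive (k : Packet f V)
  /-- the leader handles `⟨m, t⟩` -/
  | contribution (k : Packet f V)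
  /-- the leader handles `Valid(M, Σ, t)` -/
  | validSet (k : Packet f V)
  /-- the leader has messages from a quorum and broadcasts the aggregation -/
  | propose
  /-- an attested aggregation of the leader is accepted and echoed -/
  | aggregation (k : Packet f V)
  /-- a quorum of `Echo(M, ts)` -/
  | echoQuorum (M : Finset V)
  /-- `f + 1` messages `Ready(M, ts)` -/
  | readyAmplify (M : Finset V)
  /-- a quorum of `Ready(M, ts)`: response `deliver` -/
  | deliver (M : Finset V)
  /-- the timer expires: response `complain(leader)`, passed to leader election -/
  | timeout
  /-- leader election handles `Complaint(t)` -/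
  | complaint (k : Packet f V)

/-- `LocalStep timeout now p s e s' o`: at time `now` the correct process `p` in state `s` can execute
the event `e`, which leads to the state `s'` and sends `o`. -/
inductive LocalStep {f : ℕ} {V : Type*} (timeout : ℕ → ℝ) (now : ℝ) (p : Proc f) (s : LState f V) :
    Event f V → LState f V → Out f V → Prop where
  | broadcast (m : V) (h : s.myM = none) :
      LocalStep timeout now p s (.broadcast m)
        { s with myM := some m, deadline := some (now + timeout s.ts) }
        {(s.leader, .signed (.contrib m s.ts))}
  | receive (k : Packet f V) (hdst : k.dst = p) (hnew : k ∉ s.received) :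
      LocalStep timeout now p s (.receive k) { s with received := insert k s.received } ∅
  | contribution (k : Packet f V) (m : V) (hk : s.Pending k)
      (hmsg : k.msg = .signed (.contrib m s.ts)) (hlead : p = s.leader) :
      LocalStep timeout now p s (.contribution k) ((s.consume k).collect k.src m) ∅
  | validSet (k : Packet f V) (M : Finset V) (sigs : Finset (Sig f V)) (t : ℕ) (hk : s.Pending k)
      (hmsg : k.msg = .valid M sigs t) (hlead : p = s.leader) (hatt : VoteCert M sigs t) :
      LocalStep timeout now p s (.validSet k) ((s.consume k).collectValid k.src (M, sigs, t)) ∅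
  | propose (hq : 2 * f + 1 ≤ s.q.card) (hnew : ¬ s.proposed) :
      LocalStep timeout now p s .propose { s with proposed := True } (toAll s.proposal)
  | aggregation (k : Packet f V) (M : Finset V) (sigs : Finset (Sig f V)) (hk : s.Pending k)
      (hmsg : k.msg = .agg M sigs s.ts) (hsrc : k.src = s.leader) (hnew : ¬ s.echoed)
      (hatt : Attests M sigs s.ts) :
      LocalStep timeout now p s (.aggregation k) { s.consume k with echoed := True }
        (toAll (.signed (.echo M s.ts)))
  | echoQuorum (M : Finset V) (hq : 2 * f + 1 ≤ (s.senders (.echo M s.ts)).card)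
      (hnew : ¬ s.readied) :
      LocalStep timeout now p s (.echoQuorum M)
        { s with readied := True, valid := some (M, s.cert (.echo M s.ts), s.ts) }
        (toAll (.signed (.ready M s.ts)))
  | readyAmplify (M : Finset V) (hq : f + 1 ≤ (s.senders (.ready M s.ts)).card)
      (hnew : ¬ s.readied) :
      LocalStep timeout now p s (.readyAmplify M)
        { s with readied := True, valid := some (M, s.cert (.ready M s.ts), s.ts) }
        (toAll (.signed (.ready M s.ts)))
  | deliver (M : Finset V) (hq : 2 * f + 1 ≤ (s.senders (.ready M s.ts)).card)
      (hnew : ¬ s.delivered) :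
      LocalStep timeout now p s (.deliver M)
        { s with
          delivered := True
          output := some (M, s.sigs, s.cert (.ready M s.ts))
          deadline := none }
        ∅
  | timeout (d : ℝ) (hd : s.deadline = some d) (hnow : d ≤ now) :
      LocalStep timeout now p s .timeout
        (LState.complain { s with deadline := none }).1
        (LState.complain { s with deadline := none }).2
  | complaint (k : Packet f V) (hk : s.Pending k) (hmsg : k.msg = .complaint s.leTs) :
      LocalStep timeout now p s (.complaint k)
        ((s.consume k).onComplaint timeout now k.src).1
        ((s.consume k).onComplaint timeout now k.src).2

/-- Events that a process executes by itself as soon as they are enabled: all but the requests of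
the user and the arrivals of packets. -/
def Event.Internal {f : ℕ} {V : Type*} : Event f V → Prop
  | .broadcast _ => False
  | .receive _ => False
  | _ => True

/-- A global configuration: the local states and all packets sent so far. -/
structure Config (f : ℕ) (V : Type*) where
  loc : Proc f → LState f V
  sent : Set (Packet f V)

/-- Steps of the system: an event at a correct process, Byzantine processes sending packets,
or nothing (time passes). -/
inductive Action (f : ℕ) (V : Type*) where
  | run (p : Proc f) (e : Event f V)
  | byzantine (S : Set (Packet f V))
  | idle

/-- The `n`-th step of the system, at time `now`; `B` is the set of Byzantine processes. These send
anything in their own names, but the links are authenticated and signatures of correct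
processes cannot be forged. -/
inductive Step {f : ℕ} {V : Type*} (timeout : ℕ → ℝ) (B : Finset (Proc f)) (n : ℕ) (now : ℝ)
    (c : Config f V) : Action f V → Config f V → Prop where
  | run (p : Proc f) (e : Event f V) (s' : LState f V) (o : Out f V) (hp : p ∉ B)
      (hnet : ∀ k, e = .receive k → k ∈ c.sent)
      (hstep : LocalStep timeout now p (c.loc p) e s' o) :
      Step timeout B n now c (.run p e)
        { loc := Function.update c.loc p s'
          sent := c.sent ∪ {k | k.id = n ∧ k.src = p ∧ (k.dst, k.msg) ∈ o} }
  | byzantine (S : Set (Packet f V)) (hid : ∀ k ∈ S, k.id = n) (hsrc : ∀ k ∈ S, k.src ∈ B)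
      (hsig : ∀ k ∈ S, ∀ p x, p ∉ B → (p, x) ∈ k.msg.carried →
        ∃ k' ∈ c.sent, k'.src = p ∧ k'.msg = .signed x) :
      Step timeout B n now c (.byzantine S) { c with sent := c.sent ∪ S }
  | idle : Step timeout B n now c .idle c

/-- An infinite timed execution. Step `n` happens at time `time n` and leads from configuration
`cfg n` to `cfg (n + 1)`. `p₀` is the initial leader, `gst` the global stabilization time and `δ` the
bound on message delays after it. -/
structure IsExecution {f : ℕ} {V : Type*} (timeout : ℕ → ℝ) (B : Finset (Proc f)) (p₀ : Proc f)
    (gst δ : ℝ) (cfg : ℕ → Config f V) (act : ℕ → Action f V) (time : ℕ → ℝ) : Prop where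
  time_zero : time 0 = 0
  time_mono : Monotone time
  time_unbounded : Filter.Tendsto time Filter.atTop Filter.atTop
  init : cfg 0 = { loc := fun _ => LState.init V timeout p₀, sent := ∅ }
  step : ∀ n, Step timeout B n (time n) (cfg n) (act n) (cfg (n + 1))
  /-- local computation takes no time: time advances only if no handler is enabled -/
  urgent : ∀ n, time n < time (n + 1) → ∀ p ∉ B, ∀ e : Event f V, e.Internal →
    ¬ ∃ s' o, LocalStep timeout (time n) p ((cfg (n + 1)).loc p) e s' o
  /-- time does not advance beyond the expiry of a running timer -/
  timer : ∀ n, ∀ p ∉ B, ∀ d, ((cfg (n + 1)).loc p).deadline = some d → time (n + 1) ≤ max (time n) d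
  /-- partial synchrony: packets between correct processes arrive, and within `δ` after `gst` -/
  synchrony : ∀ n, ∀ k ∈ (cfg n).sent, k.src ∉ B → k.dst ∉ B →
    ∃ j, act j = .run k.dst (.receive k) ∧ time j ≤ max (time k.id) gst + δ

/-- The process `p` broadcasts a message in the execution. -/
def Broadcasts {f : ℕ} {V : Type*} (act : ℕ → Action f V) (p : Proc f) : Prop :=
  ∃ n m, act n = .run p (.broadcast m)

/-- The process `p` eventually issues a response `deliver` for a set of messages. -/
def Delivers {f : ℕ} {V : Type*} (act : ℕ → Action f V) (p : Proc f) : Prop :=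
  ∃ n M, act n = .run p (.deliver M)

end BRD

/-! The election timestamps of the correct processes are either bounded or unbounded, and delivery
follows in both cases.

Bounded case (`delivers_of_bounded`): every correct process reaches the maximal timestamp and stays
there. Once all have broadcast, no timer is restarted, so eventually every timer is off. By the
invariant `deadline_none`, a process whose timer is off has complained or has received `2f+1`
messages `Ready`. If all had complained, the leader would change once more. So some process has a
`Ready` quorum; at least `f+1` of these senders are correct, amplification makes every correct
process ready, for the same set by `ready_unique`, and all deliver.

Unbounded case (`delivers_of_unbounded`): leaving `T` takes `2f+1` complaints, and the earliest
complaint of a correct process comes from an expired timer, so `T` lasts at least its period after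
its first entry (`leave_time`). First entries of large timestamps are thus at least `6δ` apart.
After stabilization, a change made by one correct process spreads in `2δ` to all that have reached
the previous timestamp (`reached_succ`). The lag between first and last entry therefore shrinks by
`5δ` per timestamp until it is at most `2δ`. Take a late timestamp with a correct leader. Counted
from its first entry, all are present after `2δ`, the leader has heard from all after `3δ`, all have
echoed after `4δ`, are ready after `5δ` and deliver by `6δ`, when nobody can have left
(`delivers_of_leader`).

The timing argument inspects states only at a `Boundary`, where urgency excludes enabled handlers;
each invariant then turns received messages into accomplished actions. -/

namespace BRD

variable {f : ℕ} {V : Type*}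

/-! ### Local transitions and senders. -/

/-- The steps of a correct process, with the handlers of the leader election unfolded. -/
inductive Transition (timeout : ℕ → ℝ) (now : ℝ) (p : Proc f) (s : LState f V) :
    Event f V → LState f V → Out f V → Prop where
  | broadcast (m : V) (h : s.myM = none) :
      Transition timeout now p s (.broadcast m)
        { s with myM := some m, deadline := some (now + timeout s.ts) }
        {(s.leader, .signed (.contrib m s.ts))}
  | receive (k : Packet f V) (hdst : k.dst = p) (hnew : k ∉ s.received) :
      Transition timeout now p s (.receive k) { s with received := insert k s.received } ∅
  | contribution (k : Packet f V) (m : V) (hk : s.Pending k)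
      (hmsg : k.msg = .signed (.contrib m s.ts)) (hlead : p = s.leader) :
      Transition timeout now p s (.contribution k) ((s.consume k).collect k.src m) ∅
  | validSet (k : Packet f V) (M : Finset V) (sigs : Finset (Sig f V)) (t : ℕ) (hk : s.Pending k)
      (hmsg : k.msg = .valid M sigs t) (hlead : p = s.leader) (hatt : VoteCert M sigs t) :
      Transition timeout now p s (.validSet k) ((s.consume k).collectValid k.src (M, sigs, t)) ∅
  | propose (hq : 2 * f + 1 ≤ s.q.card) (hnew : ¬ s.proposed) :
      Transition timeout now p s .propose { s with proposed := True } (toAll s.proposal)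
  | aggregation (k : Packet f V) (M : Finset V) (sigs : Finset (Sig f V)) (hk : s.Pending k)
      (hmsg : k.msg = .agg M sigs s.ts) (hsrc : k.src = s.leader) (hnew : ¬ s.echoed) :
      Transition timeout now p s (.aggregation k) { s.consume k with echoed := True }
        (toAll (.signed (.echo M s.ts)))
  -- Covers both ways of becoming ready. The event stays arbitrary, and of the stored signatures
  -- only `VoteCert` is remembered.
  | ready (e : Event f V) (M : Finset V) (sigs : Finset (Sig f V))
      (hq : 2 * f + 1 ≤ (s.senders (.echo M s.ts)).card ∨
        f + 1 ≤ (s.senders (.ready M s.ts)).card)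
      (hcert : VoteCert M sigs s.ts) (hnew : ¬ s.readied) :
      Transition timeout now p s e
        { s with readied := True, valid := some (M, sigs, s.ts) }
        (toAll (.signed (.ready M s.ts)))
  | deliver (M : Finset V) (hq : 2 * f + 1 ≤ (s.senders (.ready M s.ts)).card)
      (hnew : ¬ s.delivered) :
      Transition timeout now p s (.deliver M)
        { s with
          delivered := True
          output := some (M, s.sigs, s.cert (.ready M s.ts))
          deadline := none }
        ∅
  | timeoutSilent (d : ℝ) (hd : s.deadline = some d) (hnow : d ≤ now) (hc : s.leComplained) :
      Transition timeout now p s .timeout { s with deadline := none } ∅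
  | timeoutComplain (d : ℝ) (hd : s.deadline = some d) (hnow : d ≤ now) (hc : ¬ s.leComplained) :
      Transition timeout now p s .timeout { s with deadline := none, leComplained := True }
        (toAll (.complaint s.leTs))
  | complaintSilent (k : Packet f V) (hk : s.Pending k) (hmsg : k.msg = .complaint s.leTs)
      (hle : (insert k.src s.leC).card ≤ 2 * f)
      (hc : f + 1 ≤ (insert k.src s.leC).card → s.leComplained) :
      Transition timeout now p s (.complaint k)
        { s with handled := insert k s.handled, leC := insert k.src s.leC } ∅
  | complaintAmplify (k : Packet f V) (hk : s.Pending k) (hmsg : k.msg = .complaint s.leTs)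
      (hle : (insert k.src s.leC).card ≤ 2 * f)
      (hc : f + 1 ≤ (insert k.src s.leC).card) (hnew : ¬ s.leComplained) :
      Transition timeout now p s (.complaint k)
        { s with
          handled := insert k s.handled
          leC := insert k.src s.leC
          leComplained := True }
        (toAll (.complaint s.leTs))
  | change (k : Packet f V) (o : Out f V) (hk : s.Pending k) (hmsg : k.msg = .complaint s.leTs)
      (hle : 2 * f + 1 ≤ (insert k.src s.leC).card)
      (ho : s.leComplained ∧ o = ∅ ∨ ¬ s.leComplained ∧ o = toAll (.complaint s.leTs)) :
      Transition timeout now p s (.complaint k)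
        { s with
          handled := insert k s.handled
          leTs := s.leTs + 1
          leC := ∅
          leComplained := False
          leader := Fin.ofNat (3 * f + 1) (s.leTs + 1)
          ts := s.leTs + 1
          echoed := False
          readied := False
          highValid := none
          q := ∅
          M := ∅
          sigs := ∅
          proposed := False
          deadline := some (now + timeout (s.leTs + 1)) }
        (o ∪ s.newLeaderOut (Fin.ofNat (3 * f + 1) (s.leTs + 1)) (s.leTs + 1))

theorem LState.mem_senders {s : LState f V} {x : Stmt V} {p : Proc f} :
    p ∈ s.senders x ↔ ∃ k ∈ s.received, k.src = p ∧ k.msg = .signed x := by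
  simp [LState.senders]

theorem LState.sigCount_cert (s : LState f V) (x : Stmt V) :
    sigCount (s.cert x) x = (s.senders x).card := by
  simp [sigCount, LState.cert]

theorem LocalStep.transition {timeout : ℕ → ℝ} {now : ℝ} {p : Proc f} {s s' : LState f V}
    {e : Event f V} {o : Out f V} (h : LocalStep timeout now p s e s' o) :
    Transition timeout now p s e s' o := by
  cases h with
  | broadcast m h => exact .broadcast m h
  | receive k hdst hnew => exact .receive k hdst hnew
  | contribution k m hk hmsg hlead => exact .contribution k m hk hmsg hlead
  | validSet k M sigs t hk hmsg hlead hatt => exact .validSet k M sigs t hk hmsg hlead hatt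
  | propose hq hnew => exact .propose hq hnew
  | aggregation k M sigs hk hmsg hsrc hnew hatt => exact .aggregation k M sigs hk hmsg hsrc hnew
  | echoQuorum M hq hnew =>
    exact .ready _ M _ (.inl hq) (.inl (by rwa [LState.sigCount_cert])) hnew
  | readyAmplify M hq hnew =>
    exact .ready _ M _ (.inr hq) (.inr (by rwa [LState.sigCount_cert])) hnew
  | deliver M hq hnew => exact .deliver M hq hnew
  | timeout d hd hnow =>
    by_cases hc : s.leComplained
    · simpa [LState.complain, hc] using Transition.timeoutSilent d hd hnow hc
    · simpa [LState.complain, hc] using Transition.timeoutComplain d hd hnow hc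
  | complaint k hk hmsg =>
    by_cases h2 : 2 * f + 1 ≤ (insert k.src s.leC).card
    · have h1 : f + 1 ≤ (insert k.src s.leC).card := by omega
      by_cases hc : s.leComplained
      · simpa [LState.onComplaint, LState.consume, LState.change, LState.newLeader,
          LState.newLeaderOut, LState.complain, h1, h2, hc] using
          Transition.change k ∅ hk hmsg h2 (.inl ⟨hc, rfl⟩)
      · simpa [LState.onComplaint, LState.consume, LState.change, LState.newLeader,
          LState.newLeaderOut, LState.complain, h1, h2, hc] using
          Transition.change k _ hk hmsg h2 (.inr ⟨hc, rfl⟩)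
    · by_cases h1 : f + 1 ≤ (insert k.src s.leC).card
      · by_cases hc : s.leComplained
        · simpa [LState.onComplaint, LState.consume, LState.complain, h1, h2, hc] using
            Transition.complaintSilent k hk hmsg (by omega) fun _ => hc
        · simpa [LState.onComplaint, LState.consume, LState.complain, h1, h2, hc] using
            Transition.complaintAmplify k hk hmsg (by omega) h1 hc
      · simpa [LState.onComplaint, LState.consume, LState.complain, h1, h2] using
          Transition.complaintSilent k hk hmsg (by omega) fun h => absurd h h1

/-- At least `a` processes are the source of a packet in `R` with the message `x`. -/
def Heard (R : Set (Packet f V)) (a : ℕ) (x : Msg f V) : Prop :=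
  ∃ Q : Finset (Proc f), a ≤ Q.card ∧ ∀ q ∈ Q, ∃ k ∈ R, k.src = q ∧ k.msg = x

theorem Heard.mono {R R' : Set (Packet f V)} {a : ℕ} {x : Msg f V} (h : Heard R a x)
    (hR : R ⊆ R') : Heard R' a x := by
  obtain ⟨Q, hQ, h⟩ := h
  refine ⟨Q, hQ, fun q hq => ?_⟩
  obtain ⟨k, hk, h⟩ := h q hq
  exact ⟨k, hR hk, h⟩

theorem LState.heard_iff {s : LState f V} {a : ℕ} {x : Stmt V} :
    a ≤ (s.senders x).card ↔ Heard s.received a (.signed x) := by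
  constructor
  · exact fun h => ⟨_, h, fun q hq => LState.mem_senders.1 hq⟩
  · rintro ⟨Q, hQ, h⟩
    exact hQ.trans (Finset.card_le_card fun q hq => LState.mem_senders.2 (h q hq))

/-! ### Invariants of one process. -/

/-- The invariants of the local state of a correct process. -/
structure LocalInv (s : LState f V) : Prop where
  leTs_pos : 1 ≤ s.leTs
  -- BRD starts at timestamp `0` and the election at `1`; they agree from the first leader change
  -- on.
  ts_eq : s.ts = if s.leTs = 1 then 0 else s.leTs
  leader_eq : 2 ≤ s.leTs → s.leader = Fin.ofNat (3 * f + 1) s.leTs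
  handled_received : ∀ k ∈ s.handled, k ∈ s.received
  leC_card : s.leC.card ≤ 2 * f
  leC_received : ∀ q ∈ s.leC, ∃ k ∈ s.received, k.src = q ∧ k.msg = .complaint s.leTs
  amplified : f + 1 ≤ s.leC.card → s.leComplained
  -- A consumed packet is never consumed again, so it has to have left its trace for as long as its
  -- timestamp is current. The same holds for contributions and aggregations.
  handled_complaint : ∀ k ∈ s.handled, ∀ t, k.msg = .complaint t →
    t ≤ s.leTs ∧ (t = s.leTs → k.src ∈ s.leC)
  handled_contrib : ∀ k ∈ s.handled, ∀ m t, k.msg = .signed (.contrib m t) →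
    t ≤ s.ts ∧ (t = s.ts → k.src ∈ s.q)
  handled_agg : ∀ k ∈ s.handled, ∀ M sigs t, k.msg = .agg M sigs t →
    t ≤ s.ts ∧ (t = s.ts → s.echoed)
  valid_cert : ∀ v, s.valid = some v → VoteCert v.1 v.2.1 v.2.2
  highValid_cert : ∀ v, s.highValid = some v → VoteCert v.1 v.2.1 v.2.2
  collected : s.highValid = none → ∀ p ∈ s.q, ∃ m, (p, Stmt.contrib m s.ts) ∈ s.sigs
  mem_M : ∀ m, m ∈ s.M ↔ ∃ p, (p, Stmt.contrib m s.ts) ∈ s.sigs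
  -- A timer is off either because it expired, which forces a complaint, or because a delivery under
  -- the current timestamp stopped it.
  deadline_none : s.deadline = none →
    s.leComplained ∨ ∃ M, Heard s.received (2 * f + 1) (.signed (.ready M s.ts))

theorem LocalInv.init (timeout : ℕ → ℝ) (p₀ : Proc f) :
    LocalInv (LState.init V timeout p₀) := by
  constructor <;> simp [LState.init]

theorem LocalInv.ts_le {s : LState f V} (h : LocalInv s) : s.ts ≤ s.leTs := by
  have := h.ts_eq
  split_ifs at this <;> omega

/-- The part common to the silent, amplifying and leader-changing ways of consuming a complaint. -/
theorem LocalInv.complaint {s : LState f V} (hs : LocalInv s) {k : Packet f V}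
    (hk : k ∈ s.received) (hmsg : k.msg = .complaint s.leTs) :
    (∀ k' ∈ insert k s.handled, k' ∈ s.received) ∧
    (∀ q ∈ insert k.src s.leC, ∃ k' ∈ s.received, k'.src = q ∧ k'.msg = .complaint s.leTs) ∧
    (∀ k' ∈ insert k s.handled, ∀ t, k'.msg = .complaint t →
      t ≤ s.leTs ∧ (t = s.leTs → k'.src ∈ insert k.src s.leC)) ∧
    (∀ k' ∈ insert k s.handled, ∀ m t, k'.msg = .signed (.contrib m t) →
      t ≤ s.ts ∧ (t = s.ts → k'.src ∈ s.q)) ∧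
    ∀ k' ∈ insert k s.handled, ∀ M sigs t, k'.msg = .agg M sigs t →
      t ≤ s.ts ∧ (t = s.ts → s.echoed) := by
  refine ⟨?_, fun q hq => ?_, ?_, ?_, ?_⟩
  · rintro k' (rfl | hk')
    exacts [hk, hs.handled_received k' hk']
  · rcases Finset.mem_insert.1 hq with rfl | hq
    exacts [⟨k, hk, rfl, hmsg⟩, hs.leC_received q hq]
  · rintro k' (rfl | hk') t h'
    · simp only [hmsg, Msg.complaint.injEq] at h'
      exact ⟨h'.ge, fun _ => Finset.mem_insert_self _ _⟩
    · have := hs.handled_complaint k' hk' t h'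
      exact ⟨this.1, fun h => Finset.mem_insert_of_mem (this.2 h)⟩
  · rintro k' (rfl | hk')
    · simp [hmsg]
    · exact hs.handled_contrib k' hk'
  · rintro k' (rfl | hk')
    · simp [hmsg]
    · exact hs.handled_agg k' hk'

theorem LocalInv.transition {timeout : ℕ → ℝ} {now : ℝ} {p : Proc f} {s s' : LState f V}
    {e : Event f V} {o : Out f V} (hs : LocalInv s) (h : Transition timeout now p s e s' o) :
    LocalInv s' := by
  have hts := hs.ts_le
  cases h with
  | broadcast m h => exact { hs with deadline_none := by simp }
  | receive k hdst hnew =>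
    exact { hs with
      handled_received := fun k' hk' => .inr (hs.handled_received k' hk')
      leC_received := fun q hq =>
        let ⟨k', hk', h'⟩ := hs.leC_received q hq
        ⟨k', .inr hk', h'⟩
      deadline_none := fun hd => (hs.deadline_none hd).imp_right fun ⟨M, hM⟩ =>
        ⟨M, hM.mono (Set.subset_insert _ _)⟩ }
  | contribution k m hk hmsg hlead =>
    have hreceived : ∀ k' ∈ insert k s.handled, k' ∈ s.received := by
      rintro k' (rfl | hk')
      exacts [hk.1, hs.handled_received k' hk']
    exact { hs with
      handled_received := hreceived
      handled_complaint := by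
        rintro k' (rfl | hk')
        · simp [hmsg]
        · exact hs.handled_complaint k' hk'
      handled_contrib := by
        rintro k' (rfl | hk') m' t h'
        · simp_all [LState.collect, LState.consume]
        · have := hs.handled_contrib k' hk' m' t h'
          simp_all [LState.collect, LState.consume]
      handled_agg := by
        rintro k' (rfl | hk')
        · simp [hmsg]
        · exact hs.handled_agg k' hk'
      collected := by
        intro hn p hp
        simp only [LState.collect, LState.consume, Finset.mem_insert] at hn hp ⊢
        rcases hp with rfl | hp
        · exact ⟨m, .inl rfl⟩
        · exact (hs.collected hn p hp).imp fun _ => .inr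
      mem_M := by
        intro m'
        simp only [LState.collect, LState.consume, Finset.mem_insert, hs.mem_M, Prod.mk.injEq,
          Stmt.contrib.injEq, and_true]
        constructor
        · rintro (rfl | ⟨p, hp⟩)
          exacts [⟨k.src, .inl ⟨rfl, rfl⟩⟩, ⟨p, .inr hp⟩]
        · rintro ⟨p, ⟨-, rfl⟩ | hp⟩
          exacts [.inl rfl, .inr ⟨p, hp⟩] }
  | validSet k M sigs t hk hmsg hlead hatt =>
    have hreceived : ∀ k' ∈ insert k s.handled, k' ∈ s.received := by
      rintro k' (rfl | hk')
      exacts [hk.1, hs.handled_received k' hk']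
    have hsome : ∃ v, ((s.consume k).collectValid k.src (M, sigs, t)).highValid = some v ∧
        VoteCert v.1 v.2.1 v.2.2 := by
      simp only [LState.collectValid, LState.consume]
      split
      · exact ⟨_, rfl, hatt⟩
      · rename_i w hw
        split_ifs
        exacts [⟨_, rfl, hatt⟩, ⟨_, rfl, hs.highValid_cert w hw⟩]
    obtain ⟨v, hv, hvc⟩ := hsome
    exact { hs with
      handled_received := hreceived
      handled_complaint := by
        rintro k' (rfl | hk')
        · simp [hmsg]
        · exact hs.handled_complaint k' hk'
      handled_contrib := by
        rintro k' (rfl | hk') m' t h'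
        · simp_all
        · have := hs.handled_contrib k' hk' m' t h'
          exact ⟨this.1, fun h => Finset.mem_insert_of_mem (this.2 h)⟩
      handled_agg := by
        rintro k' (rfl | hk')
        · simp [hmsg]
        · exact hs.handled_agg k' hk'
      highValid_cert := fun w hw => by
        obtain rfl : v = w := by simpa [hv] using hw
        exact hvc
      collected := fun hn => by simp [hv] at hn }
  | propose hq hnew => exact { hs with }
  | aggregation k M sigs hk hmsg hsrc hnew =>
    have hreceived : ∀ k' ∈ insert k s.handled, k' ∈ s.received := by
      rintro k' (rfl | hk')
      exacts [hk.1, hs.handled_received k' hk']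
    exact { hs with
      handled_received := hreceived
      handled_complaint := by
        rintro k' (rfl | hk')
        · simp [hmsg]
        · exact hs.handled_complaint k' hk'
      handled_contrib := by
        rintro k' (rfl | hk')
        · simp [hmsg]
        · exact hs.handled_contrib k' hk'
      handled_agg := by
        rintro k' (rfl | hk') M' sigs' t h'
        · simp only [hmsg, Msg.agg.injEq] at h'
          exact ⟨h'.2.2.ge, fun _ => trivial⟩
        · exact ⟨(hs.handled_agg k' hk' M' sigs' t h').1, fun _ => trivial⟩ }
  | ready e M sigs hq hcert hnew =>
    exact { hs with
      valid_cert := fun v hv => by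
        obtain rfl := Option.some.inj hv
        exact hcert }
  | deliver M hq hnew =>
    exact { hs with deadline_none := fun _ => .inr ⟨M, LState.heard_iff.1 hq⟩ }
  | timeoutSilent d hd hnow hc => exact { hs with deadline_none := fun _ => .inl hc }
  | timeoutComplain d hd hnow hc =>
    exact { hs with
      amplified := fun _ => trivial
      deadline_none := fun _ => .inl trivial }
  | complaintSilent k hk hmsg hle hc =>
    have := hs.complaint hk.1 hmsg
    exact { hs with
      handled_received := this.1
      leC_card := hle
      leC_received := this.2.1
      amplified := hc
      handled_complaint := this.2.2.1
      handled_contrib := this.2.2.2.1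
      handled_agg := this.2.2.2.2 }
  | complaintAmplify k hk hmsg hle hc hnew =>
    have := hs.complaint hk.1 hmsg
    exact { hs with
      handled_received := this.1
      leC_card := hle
      leC_received := this.2.1
      amplified := fun _ => trivial
      handled_complaint := this.2.2.1
      handled_contrib := this.2.2.2.1
      handled_agg := this.2.2.2.2
      deadline_none := fun _ => .inl trivial }
  | change k o hk hmsg hle ho =>
    have := hs.complaint hk.1 hmsg
    have hpos := hs.leTs_pos
    exact { hs with
      leTs_pos := by simp
      ts_eq := by simp; omega
      leader_eq := fun _ => rfl
      handled_received := this.1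
      leC_card := by simp
      leC_received := by simp
      amplified := by simp
      -- After the change, all timestamps of consumed packets lie strictly below the current one, so
      -- clearing the traces is harmless.
      handled_complaint := fun k' hk' t h' => by
        have := this.2.2.1 k' hk' t h'
        exact ⟨this.1.trans (Nat.le_succ _), fun h => by dsimp only at h; omega⟩
      handled_contrib := fun k' hk' m t h' => by
        have := this.2.2.2.1 k' hk' m t h'
        exact ⟨by dsimp only; omega, fun h => by dsimp only at h; omega⟩
      handled_agg := fun k' hk' M sigs t h' => by
        have := this.2.2.2.2 k' hk' M sigs t h'
        exact ⟨by dsimp only; omega, fun h => by dsimp only at h; omega⟩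
      highValid_cert := by simp
      collected := by simp
      mem_M := by simp
      deadline_none := by simp }

/-- The invariants that relate the local state of a correct process to the predicate `S` of the
messages that it has sent. -/
structure OutInv (S : Msg f V → Prop) (s : LState f V) : Prop where
  complained : s.leComplained → S (.complaint s.leTs)
  complained_before : ∀ t, 1 ≤ t → t < s.leTs → S (.complaint t)
  agg_le : ∀ M sigs t, S (.agg M sigs t) → t ≤ s.ts ∧ (t = s.ts → s.proposed)
  agg_unique : ∀ M sigs M' sigs' t, S (.agg M sigs t) → S (.agg M' sigs' t) → M = M'
  proposed : s.proposed → ∃ M sigs, Attests M sigs s.ts ∧ S (.agg M sigs s.ts)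
  echo_le : ∀ M t, S (.signed (.echo M t)) → t ≤ s.ts ∧ (t = s.ts → s.echoed)
  echo_unique : ∀ M M' t, S (.signed (.echo M t)) → S (.signed (.echo M' t)) → M = M'
  echoed : s.echoed → ∃ M, S (.signed (.echo M s.ts))
  readied : s.readied → ∃ M, S (.signed (.ready M s.ts))

theorem OutInv.init (timeout : ℕ → ℝ) (p₀ : Proc f) :
    OutInv (fun _ => False) (LState.init V timeout p₀) := by
  constructor <;> simp [LState.init]
  omega

/-- Without an adopted set, every counted sender left a signature in `sigs`, which makes it a
`CollectCert`; an adopted set carries its own vote certificate. -/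
theorem LocalInv.attests_proposal {s : LState f V} (hs : LocalInv s)
    (hq : 2 * f + 1 ≤ s.q.card) :
    ∃ M sigs, s.proposal = .agg M sigs s.ts ∧ Attests M sigs s.ts := by
  cases hv : s.highValid with
  | none =>
    refine ⟨s.M, s.sigs, by simp [LState.proposal, hv], .inl ⟨hq.trans ?_, hs.mem_M⟩⟩
    exact Finset.card_le_card fun p hp => by simpa using hs.collected hv p hp
  | some v =>
    exact ⟨v.1, v.2.1, by simp [LState.proposal, hv], .inr ⟨_, hs.highValid_cert v hv⟩⟩

theorem LState.proposal_eq (s : LState f V) : ∃ M sigs, s.proposal = .agg M sigs s.ts := by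
  cases hv : s.highValid with
  | none => exact ⟨s.M, s.sigs, by simp [LState.proposal, hv]⟩
  | some v => exact ⟨v.1, v.2.1, by simp [LState.proposal, hv]⟩

/-- The messages that are sent to all processes. -/
def Msg.Public : Msg f V → Prop
  | .signed (.contrib _ _) => False
  | .valid _ _ _ => False
  | _ => True

theorem LState.not_public_of_mem_newLeaderOut {s : LState f V} {p q : Proc f} {t : ℕ}
    {x : Msg f V} (h : (q, x) ∈ s.newLeaderOut p t) : ¬ x.Public := by
  unfold LState.newLeaderOut at h
  split at h
  · simp only [Set.mem_singleton_iff, Prod.mk.injEq] at h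
    simp [h.2, Msg.Public]
  · split at h
    · simp only [Set.mem_singleton_iff, Prod.mk.injEq] at h
      simp [h.2, Msg.Public]
    · exact h.elim

/-- The public messages that a transition sends. -/
theorem Transition.public_out {timeout : ℕ → ℝ} {now : ℝ} {p : Proc f} {s s' : LState f V}
    {e : Event f V} {o : Out f V} (h : Transition timeout now p s e s' o) {x : Msg f V}
    (hx : x.Public) (q q' : Proc f) (hq : (q, x) ∈ o) : (q', x) ∈ o := by
  cases h with
  | broadcast m h =>
    simp only [Set.mem_singleton_iff, Prod.mk.injEq] at hq
    simp [hq.2, Msg.Public] at hx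
  | change k o hk hmsg hle ho =>
    rcases hq with hq | hq
    · rcases ho with ⟨-, rfl⟩ | ⟨-, rfl⟩
      exacts [hq.elim, .inl hq]
    · exact absurd hx (LState.not_public_of_mem_newLeaderOut hq)
  | _ => exact hq

/-- `OutInv` mentions public messages only, so contributions and `Valid` messages do not affect it.
-/
theorem OutInv.congr {S S' : Msg f V → Prop} {s : LState f V} (h : OutInv S s)
    (hS : ∀ x, x.Public → (S' x ↔ S x)) : OutInv S' s := by
  have h1 : ∀ t, S' (.complaint t) ↔ S (.complaint t) := fun _ => hS _ trivial
  have h2 : ∀ M sigs t, S' (.agg M sigs t) ↔ S (.agg M sigs t) := fun _ _ _ => hS _ trivial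
  have h3 : ∀ M t, S' (.signed (.echo M t)) ↔ S (.signed (.echo M t)) := fun _ _ => hS _ trivial
  have h4 : ∀ M t, S' (.signed (.ready M t)) ↔ S (.signed (.ready M t)) := fun _ _ => hS _ trivial
  constructor <;> simp only [h1, h2, h3, h4]
  exacts [h.1, h.2, h.3, h.4, h.5, h.6, h.7, h.8, h.9]

theorem OutInv.transition {timeout : ℕ → ℝ} {now : ℝ} {p : Proc f} {s s' : LState f V}
    {e : Event f V} {o : Out f V} {S S' : Msg f V → Prop} (hs : OutInv S s) (hl : LocalInv s)
    (h : Transition timeout now p s e s' o)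
    (hS : ∀ x, S' x ↔ S x ∨ ∃ q, (q, x) ∈ o) : OutInv S' s' := by
  have hts := hl.ts_le
  have quiet : (∀ x, x.Public → ∀ q, (q, x) ∉ o) → OutInv S' s := fun ho =>
    hs.congr fun x hx => by simp [hS, ho x hx]
  have all : ∀ y : Msg f V, o = toAll y → ∀ x, S' x ↔ S x ∨ x = y := fun y hy x => by
    rw [hS, hy]
    simp [toAll]
  cases h with
  | broadcast m h =>
    exact { quiet (by rintro x hx q hq; simp_all [Msg.Public]) with }
  | receive k hdst hnew => exact { quiet (fun _ _ _ hq => hq.elim) with }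
  | contribution k m hk hmsg hlead => exact { quiet (fun _ _ _ hq => hq.elim) with }
  | validSet k M sigs t hk hmsg hlead hatt => exact { quiet (fun _ _ _ hq => hq.elim) with }
  | propose hq hnew =>
    obtain ⟨M, sigs, hM, hatt⟩ := hl.attests_proposal hq
    have hS' := all _ rfl
    rw [hM] at hS'
    -- The flag is still unset, so no aggregation of the current timestamp has been sent; this gives
    -- uniqueness. The echo case is alike.
    have hno : ∀ M sigs, ¬ S (.agg M sigs s.ts) := fun M sigs h =>
      hnew ((hs.agg_le M sigs _ h).2 rfl)
    constructor <;> simp only [hS', reduceCtorEq, or_false, Msg.agg.injEq]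
    · exact hs.complained
    · exact hs.complained_before
    · rintro M' sigs' t (h | h)
      · exact ⟨(hs.agg_le _ _ _ h).1, fun _ => trivial⟩
      · exact ⟨h.2.2.le, fun _ => trivial⟩
    · rintro M₁ sigs₁ M₂ sigs₂ t (h₁ | h₁) (h₂ | h₂)
      · exact hs.agg_unique _ _ _ _ _ h₁ h₂
      · exact absurd (h₂.2.2 ▸ h₁) (hno _ _)
      · exact absurd (h₁.2.2 ▸ h₂) (hno _ _)
      · exact h₁.1.trans h₂.1.symm
    · exact fun _ => ⟨M, sigs, hatt, .inr ⟨rfl, rfl, trivial⟩⟩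
    · exact hs.echo_le
    · exact hs.echo_unique
    · exact hs.echoed
    · exact hs.readied
  | aggregation k M sigs hk hmsg hsrc hnew =>
    have hS' := all _ rfl
    have hno : ∀ M, ¬ S (.signed (.echo M s.ts)) := fun M h =>
      hnew ((hs.echo_le M _ h).2 rfl)
    constructor <;> simp only [hS', reduceCtorEq, or_false, Msg.signed.injEq, Stmt.echo.injEq]
    · exact hs.complained
    · exact hs.complained_before
    · exact hs.agg_le
    · exact hs.agg_unique
    · exact hs.proposed
    · rintro M' t (h | h)
      · exact ⟨(hs.echo_le _ _ h).1, fun _ => trivial⟩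
      · exact ⟨h.2.le, fun _ => trivial⟩
    · rintro M₁ M₂ t (h₁ | h₁) (h₂ | h₂)
      · exact hs.echo_unique _ _ _ h₁ h₂
      · exact absurd (h₂.2 ▸ h₁) (hno _)
      · exact absurd (h₁.2 ▸ h₂) (hno _)
      · exact h₁.1.trans h₂.1.symm
    · exact fun _ => ⟨M, .inr ⟨rfl, rfl⟩⟩
    · exact hs.readied
  | ready e M sigs hq hcert hnew =>
    have hS' := all _ rfl
    constructor <;> simp only [hS', reduceCtorEq, or_false, Msg.signed.injEq]
    · exact hs.complained
    · exact hs.complained_before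
    · exact hs.agg_le
    · exact hs.agg_unique
    · exact hs.proposed
    · exact hs.echo_le
    · exact hs.echo_unique
    · exact hs.echoed
    · exact fun _ => ⟨M, .inr rfl⟩
  | deliver M hq hnew => exact { quiet (fun _ _ _ hq => hq.elim) with }
  | timeoutSilent d hd hnow hc => exact { quiet (fun _ _ _ hq => hq.elim) with }
  | timeoutComplain d hd hnow hc =>
    have hS' := all _ rfl
    constructor <;> simp only [hS', reduceCtorEq, or_false]
    · simp
    · exact fun t h1 h2 => .inl (hs.complained_before t h1 h2)
    · exact hs.agg_le
    · exact hs.agg_unique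
    · exact hs.proposed
    · exact hs.echo_le
    · exact hs.echo_unique
    · exact hs.echoed
    · exact hs.readied
  | complaintSilent k hk hmsg hle hc => exact { quiet (fun _ _ _ hq => hq.elim) with }
  | complaintAmplify k hk hmsg hle hc hnew =>
    have hS' := all _ rfl
    constructor <;> simp only [hS', reduceCtorEq, or_false]
    · simp
    · exact fun t h1 h2 => .inl (hs.complained_before t h1 h2)
    · exact hs.agg_le
    · exact hs.agg_unique
    · exact hs.proposed
    · exact hs.echo_le
    · exact hs.echo_unique
    · exact hs.echoed
    · exact hs.readied
  | change k o hk hmsg hle ho =>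
    have hS' : ∀ x, x.Public → (S' x ↔ S x ∨ ∃ q, (q, x) ∈ o) := fun x hx => by
      rw [hS]
      refine or_congr_right (exists_congr fun q => ⟨fun h => ?_, .inl⟩)
      exact h.resolve_right fun h => LState.not_public_of_mem_newLeaderOut h hx
    -- A process that changes the leader has complained at the latest in this very step, since
    -- `2f+1` complaints also trigger amplification.
    have hc : S' (.complaint s.leTs) := by
      rw [hS' (.complaint s.leTs) trivial]
      rcases ho with ⟨hc, -⟩ | ⟨-, rfl⟩
      exacts [.inl (hs.complained hc), .inr ⟨p, rfl⟩]
    have hS'' : ∀ x, x.Public → (∀ t, x ≠ .complaint t) → (S' x ↔ S x) := fun x hx hne => by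
      rw [hS' x hx]
      refine ⟨fun h => h.resolve_right ?_, .inl⟩
      rintro ⟨q, hq⟩
      rcases ho with ⟨-, rfl⟩ | ⟨-, rfl⟩
      exacts [hq.elim, hne _ hq]
    have h2 : ∀ M sigs t, S' (.agg M sigs t) ↔ S (.agg M sigs t) := fun _ _ _ =>
      hS'' _ trivial (by simp)
    have h3 : ∀ M t, S' (.signed (.echo M t)) ↔ S (.signed (.echo M t)) := fun _ _ =>
      hS'' _ trivial (by simp)
    constructor <;> simp only [h2, h3, false_implies]
    · intro t h1 ht
      rcases Nat.lt_succ_iff_lt_or_eq.1 ht with ht | rfl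
      · exact (hS _).2 (.inl (hs.complained_before t h1 ht))
      · exact hc
    · intro M sigs t h
      have := (hs.agg_le M sigs t h).1
      omega
    · exact hs.agg_unique
    · intro M t h
      have := (hs.echo_le M t h).1
      omega
    · exact hs.echo_unique

/-! ### Invariants along an execution. -/

/-- The process `p` has sent the message `x`. -/
def Sent (c : Config f V) (p : Proc f) (x : Msg f V) : Prop :=
  ∃ k ∈ c.sent, k.src = p ∧ k.msg = x

section Execution

variable {timeout : ℕ → ℝ} {B : Finset (Proc f)} {p₀ : Proc f} {gst δ : ℝ}
  {cfg : ℕ → Config f V} {act : ℕ → Action f V} {time : ℕ → ℝ}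

/-- A correct process changes state, and packets in its name appear, only through its own
transitions: Byzantine packets bear Byzantine sources. -/
theorem IsExecution.step_cases (h : IsExecution timeout B p₀ gst δ cfg act time) (n : ℕ)
    {p : Proc f} (hp : p ∉ B) :
    ((cfg (n + 1)).loc p = (cfg n).loc p ∧
      ∀ k, k.src = p → (k ∈ (cfg (n + 1)).sent ↔ k ∈ (cfg n).sent)) ∨
    ∃ e s' o, act n = .run p e ∧ (cfg (n + 1)).loc p = s' ∧
      Transition timeout (time n) p ((cfg n).loc p) e s' o ∧
      (∀ k, k.src = p →
        (k ∈ (cfg (n + 1)).sent ↔ k ∈ (cfg n).sent ∨ k.id = n ∧ (k.dst, k.msg) ∈ o)) ∧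
      ∀ k, e = .receive k → k ∈ (cfg n).sent := by
  have hs := h.step n
  generalize hc : cfg (n + 1) = c at hs ⊢
  generalize ha : act n = a at hs ⊢
  cases hs with
  | run q e s' o hq hnet hstep =>
    by_cases hqp : q = p
    · subst hqp
      refine .inr ⟨e, s', o, rfl, by simp, hstep.transition, fun k hk => ?_, hnet⟩
      simp [hk]
    · refine .inl ⟨by simp [Function.update_of_ne (Ne.symm hqp)], fun k hk => ?_⟩
      simp [hk, Ne.symm hqp]
  | byzantine S hid hsrc hsig =>
    refine .inl ⟨rfl, fun k hk => ?_⟩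
    have : k ∉ S := fun hS => hp (hk ▸ hsrc k hS)
    simp [this]
  | idle => exact .inl ⟨rfl, fun _ _ => Iff.rfl⟩

theorem IsExecution.sent_subset (h : IsExecution timeout B p₀ gst δ cfg act time) {m n : ℕ}
    (hmn : m ≤ n) : (cfg m).sent ⊆ (cfg n).sent := by
  induction hmn with
  | refl => exact subset_rfl
  | step _ ih =>
    refine ih.trans ?_
    rename_i n _
    have hs := h.step n
    generalize cfg (n + 1) = c at hs ⊢
    generalize act n = a at hs
    cases hs with
    | run => exact Set.subset_union_left
    | byzantine => exact Set.subset_union_left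
    | idle => exact subset_rfl

theorem IsExecution.id_lt (h : IsExecution timeout B p₀ gst δ cfg act time) (n : ℕ) :
    ∀ k ∈ (cfg n).sent, k.id < n := by
  induction n with
  | zero => simp [h.init]
  | succ n ih =>
    intro k hk
    have hs := h.step n
    generalize cfg (n + 1) = c at hs hk
    generalize act n = a at hs
    cases hs with
    | run p e s' o hp hnet hstep =>
      rcases hk with hk | hk
      · exact (ih k hk).trans n.lt_succ_self
      · exact hk.1.trans_lt n.lt_succ_self
    | byzantine S hid hsrc hsig =>
      rcases hk with hk | hk
      · exact (ih k hk).trans n.lt_succ_self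
      · exact (hid k hk).trans_lt n.lt_succ_self
    | idle => exact (ih k hk).trans n.lt_succ_self

/-- `Sent` forgets the destination; this recovers a copy addressed to any chosen process. -/
theorem IsExecution.public_sent (h : IsExecution timeout B p₀ gst δ cfg act time) (n : ℕ)
    {k : Packet f V} (hk : k ∈ (cfg n).sent) (hsrc : k.src ∉ B) (hx : k.msg.Public) (q : Proc f) :
    { k with dst := q } ∈ (cfg n).sent := by
  induction n with
  | zero => simp [h.init] at hk
  | succ n ih =>
    rcases h.step_cases n hsrc with ⟨-, hsent⟩ | ⟨e, s', o, -, -, htr, hsent, -⟩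
    · rw [hsent _ rfl] at hk
      exact (hsent { k with dst := q } rfl).2 (ih hk)
    · rw [hsent _ rfl] at hk
      rw [hsent { k with dst := q } rfl]
      exact hk.imp ih fun hk => ⟨hk.1, htr.public_out hx _ _ hk.2⟩

theorem IsExecution.localInv (h : IsExecution timeout B p₀ gst δ cfg act time) (n : ℕ)
    {p : Proc f} (hp : p ∉ B) : LocalInv ((cfg n).loc p) := by
  induction n with
  | zero =>
    rw [h.init]
    exact .init _ _
  | succ n ih =>
    rcases h.step_cases n hp with ⟨hloc, -⟩ | ⟨e, s', o, -, hloc, htr, -⟩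
    · rwa [hloc]
    · rw [hloc]
      exact ih.transition htr

theorem IsExecution.sent_succ (n : ℕ) {p : Proc f} {o : Out f V}
    (hsent : ∀ k : Packet f V, k.src = p →
      (k ∈ (cfg (n + 1)).sent ↔ k ∈ (cfg n).sent ∨ k.id = n ∧ (k.dst, k.msg) ∈ o))
    (x : Msg f V) : Sent (cfg (n + 1)) p x ↔ Sent (cfg n) p x ∨ ∃ q, (q, x) ∈ o := by
  constructor
  · rintro ⟨k, hk, hsrc, rfl⟩
    rw [hsent k hsrc] at hk
    exact hk.imp (fun hk => ⟨k, hk, hsrc, rfl⟩) fun hk => ⟨_, hk.2⟩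
  · rintro (⟨k, hk, hsrc, rfl⟩ | ⟨q, hq⟩)
    · exact ⟨k, (hsent k hsrc).2 (.inl hk), hsrc, rfl⟩
    · exact ⟨⟨n, p, q, x⟩, (hsent _ rfl).2 (.inr ⟨rfl, hq⟩), rfl, rfl⟩

theorem IsExecution.outInv (h : IsExecution timeout B p₀ gst δ cfg act time) (n : ℕ)
    {p : Proc f} (hp : p ∉ B) : OutInv (Sent (cfg n) p) ((cfg n).loc p) := by
  induction n with
  | zero =>
    have : Sent (cfg 0) p = fun _ => False := by
      funext x
      simp [Sent, h.init]
    rw [this, h.init]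
    exact .init _ _
  | succ n ih =>
    rcases h.step_cases n hp with ⟨hloc, hsent⟩ | ⟨e, s', o, -, hloc, htr, hsent, -⟩
    · rw [hloc]
      refine ih.congr fun x _ => exists_congr fun k => ?_
      rw [and_congr_left_iff]
      exact fun hk => hsent k hk.1
    · rw [hloc]
      exact ih.transition (h.localInv n hp) htr (IsExecution.sent_succ n hsent)

theorem IsExecution.received_sent (h : IsExecution timeout B p₀ gst δ cfg act time) (n : ℕ)
    {p : Proc f} (hp : p ∉ B) : ((cfg n).loc p).received ⊆ (cfg n).sent := by
  induction n with
  | zero => simp [h.init, LState.init]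
  | succ n ih =>
    have hmono := h.sent_subset n.le_succ
    rcases h.step_cases n hp with ⟨hloc, -⟩ | ⟨e, s', o, -, hloc, htr, -, hnet⟩
    · rw [hloc]
      exact ih.trans hmono
    · rw [hloc]
      cases htr with
      | receive k hdst hnew =>
        rintro k' (rfl | hk')
        exacts [hmono (hnet _ rfl), hmono (ih hk')]
      | _ => exact ih.trans hmono

end Execution

/-! ### Causes of sent messages. -/

section Transition

variable {timeout : ℕ → ℝ} {now : ℝ} {p q : Proc f} {s s' : LState f V} {e : Event f V}
  {o : Out f V}

theorem Transition.ready_out (h : Transition timeout now p s e s' o) {M : Finset V} {t : ℕ}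
    (hq : (q, .signed (.ready M t)) ∈ o) :
    Heard s.received (2 * f + 1) (.signed (.echo M t)) ∨
      Heard s.received (f + 1) (.signed (.ready M t)) := by
  cases h with
  | propose _ _ =>
    obtain ⟨M', sigs', h⟩ := s.proposal_eq
    simp [toAll, h] at hq
  | ready e M' sigs' hM' _ _ =>
    simp only [toAll, Set.mem_ofPred_eq, Msg.signed.injEq, Stmt.ready.injEq] at hq
    obtain ⟨rfl, rfl⟩ := hq
    exact hM'.imp LState.heard_iff.1 LState.heard_iff.1
  | change k o hk hmsg hle ho =>
    rcases hq with hq | hq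
    · rcases ho with ⟨-, rfl⟩ | ⟨-, rfl⟩
      · exact hq.elim
      · simp [toAll] at hq
    · exact absurd trivial (LState.not_public_of_mem_newLeaderOut hq)
  | _ => simp [toAll] at hq

theorem Transition.echo_out (h : Transition timeout now p s e s' o) {M : Finset V} {t : ℕ}
    (hq : (q, .signed (.echo M t)) ∈ o) :
    t = s.ts ∧ ∃ sigs, ∃ k ∈ s.received, k.src = s.leader ∧ k.msg = .agg M sigs t := by
  cases h with
  | propose _ _ =>
    obtain ⟨M', sigs', h⟩ := s.proposal_eq
    simp [toAll, h] at hq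
  | aggregation k M' sigs hk hmsg hsrc _ =>
    simp only [toAll, Set.mem_ofPred_eq, Msg.signed.injEq, Stmt.echo.injEq] at hq
    obtain ⟨rfl, rfl⟩ := hq
    exact ⟨rfl, sigs, k, hk.1, hsrc, hmsg⟩
  | change k o hk hmsg hle ho =>
    rcases hq with hq | hq
    · rcases ho with ⟨-, rfl⟩ | ⟨-, rfl⟩
      · exact hq.elim
      · simp [toAll] at hq
    · exact absurd trivial (LState.not_public_of_mem_newLeaderOut hq)
  | _ => simp [toAll] at hq

theorem Transition.complaint_out (h : Transition timeout now p s e s' o) {t : ℕ}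
    (hq : (q, .complaint t) ∈ o) :
    t = s.leTs ∧ ((∃ d, s.deadline = some d ∧ d ≤ now) ∨
      ∃ k ∈ s.received, k.msg = .complaint s.leTs ∧ f + 1 ≤ (insert k.src s.leC).card) := by
  cases h with
  | propose _ _ =>
    obtain ⟨M', sigs', h⟩ := s.proposal_eq
    simp [toAll, h] at hq
  | timeoutComplain d hd hnow hc =>
    simp only [toAll, Set.mem_ofPred_eq, Msg.complaint.injEq] at hq
    exact ⟨hq, .inl ⟨d, hd, hnow⟩⟩
  | complaintAmplify k hk hmsg _ hc _ =>
    simp only [toAll, Set.mem_ofPred_eq, Msg.complaint.injEq] at hq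
    exact ⟨hq, .inr ⟨k, hk.1, hmsg, hc⟩⟩
  | change k o hk hmsg hle ho =>
    rcases hq with hq | hq
    · rcases ho with ⟨-, rfl⟩ | ⟨-, rfl⟩
      · exact hq.elim
      · simp only [toAll, Set.mem_ofPred_eq, Msg.complaint.injEq] at hq
        exact ⟨hq, .inr ⟨k, hk.1, hmsg, by omega⟩⟩
    · exact absurd trivial (LState.not_public_of_mem_newLeaderOut hq)
  | _ => simp [toAll] at hq

theorem LocalInv.heard_insert (hs : LocalInv s) {k : Packet f V} (hk : k ∈ s.received)
    (hmsg : k.msg = .complaint s.leTs) {a : ℕ} (ha : a ≤ (insert k.src s.leC).card) :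
    Heard s.received a (.complaint s.leTs) :=
  ⟨_, ha, (hs.complaint hk hmsg).2.1⟩

end Transition

/-! ### Quorum intersection, uniqueness of votes, and the timing of complaints. -/

theorem Heard.exists_correct {B : Finset (Proc f)} (hB : B.card ≤ f) {c : Config f V}
    {x : Msg f V} (h : Heard c.sent (f + 1) x) : ∃ q ∉ B, Sent c q x := by
  obtain ⟨Q, hQ, h⟩ := h
  obtain ⟨q, hq, hqB⟩ := Finset.exists_mem_notMem_of_card_lt_card
    (show B.card < Q.card by omega)
  exact ⟨q, hqB, h q hq⟩

/-- Two sets of `2f+1` among `3f+1` processes share at least `f+1`, one of which is correct. -/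
theorem Heard.exists_common {B : Finset (Proc f)} (hB : B.card ≤ f) {c : Config f V}
    {x y : Msg f V} (hx : Heard c.sent (2 * f + 1) x) (hy : Heard c.sent (2 * f + 1) y) :
    ∃ q ∉ B, Sent c q x ∧ Sent c q y := by
  obtain ⟨Q, hQ, hx⟩ := hx
  obtain ⟨Q', hQ', hy⟩ := hy
  have hle : (Q ∪ Q').card ≤ 3 * f + 1 := by
    simpa using Finset.card_le_univ (Q ∪ Q')
  have := Finset.card_union_add_card_inter Q Q'
  obtain ⟨q, hq, hqB⟩ := Finset.exists_mem_notMem_of_card_lt_card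
    (show B.card < (Q ∩ Q').card by omega)
  rw [Finset.mem_inter] at hq
  exact ⟨q, hqB, hx q hq.1, hy q hq.2⟩

theorem two_mul_lt_card_compl {B : Finset (Proc f)} (hB : B.card ≤ f) :
    2 * f + 1 ≤ Bᶜ.card := by
  rw [Finset.card_compl, Fintype.card_fin]
  omega

theorem Heard.weaken {R : Set (Packet f V)} {a b : ℕ} {x : Msg f V} (h : Heard R b x)
    (hab : a ≤ b) : Heard R a x := by
  obtain ⟨Q, hQ, h⟩ := h
  exact ⟨Q, hab.trans hQ, h⟩

section Execution

variable {timeout : ℕ → ℝ} {B : Finset (Proc f)} {p₀ : Proc f} {gst δ : ℝ}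
  {cfg : ℕ → Config f V} {act : ℕ → Action f V} {time : ℕ → ℝ}

theorem IsExecution.sent_mono (h : IsExecution timeout B p₀ gst δ cfg act time) {m n : ℕ}
    (hmn : m ≤ n) {p : Proc f} {x : Msg f V} (hx : Sent (cfg m) p x) : Sent (cfg n) p x := by
  obtain ⟨k, hk, h'⟩ := hx
  exact ⟨k, h.sent_subset hmn hk, h'⟩

/-- What a correct process has newly sent comes from a transition of this process. -/
theorem IsExecution.sent_cases (h : IsExecution timeout B p₀ gst δ cfg act time) {n : ℕ}
    {p : Proc f} (hp : p ∉ B) {x : Msg f V} (hx : Sent (cfg (n + 1)) p x) :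
    Sent (cfg n) p x ∨ ∃ e s' o q, Transition timeout (time n) p ((cfg n).loc p) e s' o ∧
      (q, x) ∈ o := by
  rcases h.step_cases n hp with ⟨-, hsent⟩ | ⟨e, s', o, -, -, htr, hsent, -⟩
  · obtain ⟨k, hk, hsrc, hmsg⟩ := hx
    exact .inl ⟨k, (hsent k hsrc).1 hk, hsrc, hmsg⟩
  · rw [IsExecution.sent_succ n hsent] at hx
    exact hx.imp_right fun ⟨q, hq⟩ => ⟨e, s', o, q, htr, hq⟩

theorem IsExecution.not_sent_zero (h : IsExecution timeout B p₀ gst δ cfg act time) {p : Proc f}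
    {x : Msg f V} : ¬ Sent (cfg 0) p x := by
  simp [Sent, h.init]

/-- An amplified `Ready` rests on an earlier `Ready` of a correct process; going back in time ends
at an echo quorum. -/
theorem IsExecution.ready_heard (h : IsExecution timeout B p₀ gst δ cfg act time)
    (hB : B.card ≤ f) (n : ℕ) {p : Proc f} (hp : p ∉ B) {M : Finset V} {t : ℕ}
    (hs : Sent (cfg n) p (.signed (.ready M t))) :
    Heard (cfg n).sent (2 * f + 1) (.signed (.echo M t)) := by
  induction n generalizing p with
  | zero => exact (h.not_sent_zero hs).elim
  | succ n ih =>
    have hmono := h.sent_subset n.le_succ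
    rcases h.sent_cases hp hs with hs | ⟨e, s', o, q, htr, hq⟩
    · exact (ih hp hs).mono hmono
    · rcases htr.ready_out hq with h' | h'
      · exact h'.mono ((h.received_sent n hp).trans hmono)
      · obtain ⟨q, hqB, hq⟩ := (h'.mono (h.received_sent n hp)).exists_correct hB
        exact (ih hqB hq).mono hmono

theorem IsExecution.ready_unique (h : IsExecution timeout B p₀ gst δ cfg act time)
    (hB : B.card ≤ f) (n : ℕ) {p q : Proc f} (hp : p ∉ B) (hq : q ∉ B) {M M' : Finset V} {t : ℕ}
    (hM : Sent (cfg n) p (.signed (.ready M t))) (hM' : Sent (cfg n) q (.signed (.ready M' t))) :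
    M = M' := by
  obtain ⟨r, hr, h1, h2⟩ :=
    (h.ready_heard hB n hp hM).exists_common hB (h.ready_heard hB n hq hM')
  exact (h.outInv n hr).echo_unique _ _ _ h1 h2

/-- The bound `2 ≤ t` excludes the arbitrary initial leader; from then on the leader is the
round-robin one. -/
theorem IsExecution.echo_agg (h : IsExecution timeout B p₀ gst δ cfg act time) (n : ℕ)
    {p : Proc f} (hp : p ∉ B) {M : Finset V} {t : ℕ} (ht : 2 ≤ t)
    (hs : Sent (cfg n) p (.signed (.echo M t))) :
    ∃ sigs, Sent (cfg n) (Fin.ofNat (3 * f + 1) t) (.agg M sigs t) := by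
  induction n with
  | zero => exact (h.not_sent_zero hs).elim
  | succ n ih =>
    rcases h.sent_cases hp hs with hs | ⟨e, s', o, q, htr, hq⟩
    · obtain ⟨sigs, h'⟩ := ih hs
      exact ⟨sigs, h.sent_mono n.le_succ h'⟩
    · obtain ⟨rfl, sigs, k, hk, hsrc, hmsg⟩ := htr.echo_out hq
      have hl := h.localInv n hp
      have hts := hl.ts_eq
      have hle := hl.ts_le
      refine ⟨sigs, k, h.sent_subset n.le_succ (h.received_sent n hp hk), ?_, hmsg⟩
      rw [hsrc, hl.leader_eq (by omega), hts, if_neg (by omega)]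

/-- Timestamps grow by one at a time, so `p` has passed through `t` and left it on a quorum of
complaints. -/
theorem IsExecution.complaint_heard (h : IsExecution timeout B p₀ gst δ cfg act time) (n : ℕ)
    {p : Proc f} (hp : p ∉ B) {t : ℕ} (ht : 1 ≤ t) (htp : t < ((cfg n).loc p).leTs) :
    Heard (cfg n).sent (2 * f + 1) (.complaint t) := by
  induction n with
  | zero =>
    simp only [h.init, LState.init] at htp
    omega
  | succ n ih =>
    have hmono := h.sent_subset n.le_succ
    rcases h.step_cases n hp with ⟨hloc, -⟩ | ⟨e, s', o, -, hloc, htr, -⟩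
    · rw [hloc] at htp
      exact (ih htp).mono hmono
    · rw [hloc] at htp
      cases htr with
      | change k o hk hmsg hle ho =>
        rcases Nat.lt_succ_iff_lt_or_eq.1 htp with ht | rfl
        · exact (ih ht).mono hmono
        · exact ((h.localInv n hp).heard_insert hk.1 hmsg hle).mono
            ((h.received_sent n hp).trans hmono)
      | _ => exact (ih htp).mono hmono

theorem IsExecution.loc_mono (h : IsExecution timeout B p₀ gst δ cfg act time) {p : Proc f}
    (hp : p ∉ B) {m n : ℕ} (hmn : m ≤ n) :
    ((cfg m).loc p).leTs ≤ ((cfg n).loc p).leTs ∧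
      ((cfg m).loc p).received ⊆ ((cfg n).loc p).received ∧
      (((cfg m).loc p).myM ≠ none → ((cfg n).loc p).myM ≠ none) := by
  induction hmn with
  | refl => exact ⟨le_rfl, subset_rfl, id⟩
  | step _ ih =>
    rename_i n _
    rcases h.step_cases n hp with ⟨hloc, -⟩ | ⟨e, s', o, -, hloc, htr, -⟩
    · rwa [hloc]
    · rw [hloc]
      cases htr with
      | broadcast m hm => exact ⟨ih.1, ih.2.1, by simp⟩
      | receive k _ _ => exact ⟨ih.1, ih.2.1.trans (Set.subset_insert _ _), ih.2.2⟩
      | change k o _ _ _ _ => exact ⟨ih.1.trans (Nat.le_succ _), ih.2⟩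
      | _ => exact ih

theorem IsExecution.delivers (h : IsExecution timeout B p₀ gst δ cfg act time) {p : Proc f}
    (hp : p ∉ B) {n : ℕ} (hd : ((cfg n).loc p).delivered) : Delivers act p := by
  induction n with
  | zero => simp [h.init, LState.init] at hd
  | succ n ih =>
    rcases h.step_cases n hp with ⟨hloc, -⟩ | ⟨e, s', o, ha, hloc, htr, -⟩
    · rw [hloc] at hd
      exact ih hd
    · rw [hloc] at hd
      cases htr with
      | deliver M _ _ => exact ⟨n, M, ha⟩
      | _ => exact ih hd

/-- In step `i`, the process `p` sent to the leader of timestamp `T` an attested valid set, or a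
message with this timestamp. -/
def Joined (c : Config f V) (p : Proc f) (T i : ℕ) : Prop :=
  ∃ k ∈ c.sent, k.id = i ∧ k.src = p ∧ k.dst = Fin.ofNat (3 * f + 1) T ∧
    ((∃ m, k.msg = .signed (.contrib m T)) ∨
      ∃ M sigs t, k.msg = .valid M sigs t ∧ VoteCert M sigs t)

/-- On entering timestamp `T`, a process sends to the leader of `T` its valid set, or the message
that it broadcast. -/
theorem IsExecution.entry (h : IsExecution timeout B p₀ gst δ cfg act time) {p : Proc f}
    (hp : p ∉ B) {T : ℕ} (hT : 2 ≤ T) (n : ℕ) (hn : ((cfg n).loc p).leTs = T) :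
    ∃ i < n, ((cfg (i + 1)).loc p).leTs = T ∧ (((cfg i).loc p).myM = none ∨
      Joined (cfg n) p T i) := by
  induction n with
  | zero =>
    simp only [h.init, LState.init] at hn
    omega
  | succ n ih =>
    have hmono := h.sent_subset n.le_succ
    have old : ((cfg n).loc p).leTs = T → ∃ i < n + 1, ((cfg (i + 1)).loc p).leTs = T ∧
        (((cfg i).loc p).myM = none ∨ Joined (cfg (n + 1)) p T i) := fun hn => by
      obtain ⟨i, hi, hiT, h'⟩ := ih hn
      exact ⟨i, hi.trans n.lt_succ_self, hiT,
        h'.imp_right fun ⟨k, hk, h'⟩ => ⟨k, hmono hk, h'⟩⟩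
    rcases h.step_cases n hp with ⟨hloc, -⟩ | ⟨e, s', o, ha, hloc, htr, hsent, -⟩
    · exact old (hloc ▸ hn)
    · have hn' := hn
      rw [hloc] at hn'
      cases htr with
      | change k o hk hmsg hle ho =>
        dsimp only at hn'
        refine ⟨n, n.lt_succ_self, hn, ?_⟩
        have key : ∀ x, (Fin.ofNat (3 * f + 1) T, x) ∈ ((cfg n).loc p).newLeaderOut
            (Fin.ofNat (3 * f + 1) T) T → ∃ k ∈ (cfg (n + 1)).sent, k.id = n ∧ k.src = p ∧
              k.dst = Fin.ofNat (3 * f + 1) T ∧ k.msg = x := fun x hx =>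
          ⟨⟨n, p, _, x⟩, (hsent _ rfl).2 (.inr ⟨rfl, .inr (by rwa [hn'])⟩), rfl, rfl, rfl, rfl⟩
        cases hv : ((cfg n).loc p).valid with
        | some v =>
          obtain ⟨k, hk, h1, h2, h3, h4⟩ := key (.valid v.1 v.2.1 v.2.2)
            (by simp [LState.newLeaderOut, hv])
          exact .inr ⟨k, hk, h1, h2, h3, .inr ⟨_, _, _, h4, (h.localInv n hp).valid_cert v hv⟩⟩
        | none =>
          cases hm : ((cfg n).loc p).myM with
          | none => exact .inl rfl
          | some m =>
            obtain ⟨k, hk, h1, h2, h3, h4⟩ := key (.signed (.contrib m T))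
              (by simp [LState.newLeaderOut, hv, hm])
            exact .inr ⟨k, hk, h1, h2, h3, .inl ⟨m, h4⟩⟩
      | _ => exact old hn'

/-- Under timestamp `T` the timer is set only on entering `T` or by a broadcast, and neither occurs
before time `a`. -/
theorem IsExecution.deadline_le (h : IsExecution timeout B p₀ gst δ cfg act time) {T : ℕ}
    (hT : 2 ≤ T) {a : ℝ} (ha : ∀ i, ∀ p ∉ B, T ≤ ((cfg (i + 1)).loc p).leTs → a ≤ time i)
    (n : ℕ) {p : Proc f} (hp : p ∉ B) (hn : ((cfg n).loc p).leTs = T) {d : ℝ}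
    (hd : ((cfg n).loc p).deadline = some d) : a + timeout T ≤ d := by
  induction n with
  | zero =>
    simp only [h.init, LState.init] at hn
    omega
  | succ n ih =>
    have ha' := ha n p hp hn.ge
    rcases h.step_cases n hp with ⟨hloc, -⟩ | ⟨e, s', o, -, hloc, htr, -⟩
    · rw [hloc] at hn hd
      exact ih hn hd
    · rw [hloc] at hn hd
      cases htr with
      | broadcast m hm =>
        dsimp only at hn hd
        have hts := (h.localInv n hp).ts_eq
        rw [if_neg (by omega), hn] at hts
        rw [hts, Option.some.injEq] at hd
        linarith
      | change k o _ _ _ _ =>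
        dsimp only at hn hd
        rw [hn, Option.some.injEq] at hd
        linarith
      | deliver M _ _ => simp at hd
      | timeoutSilent d _ _ _ => simp at hd
      | timeoutComplain d _ _ _ => simp at hd
      | _ => exact ih hn hd

/-- If timestamp `T` is entered at time `a` at the earliest, then no correct process complains
about its leader before time `a + timeout T`. -/
theorem IsExecution.complaint_time (h : IsExecution timeout B p₀ gst δ cfg act time)
    (hB : B.card ≤ f) {T : ℕ} (hT : 2 ≤ T) {a : ℝ}
    (ha : ∀ i, ∀ p ∉ B, T ≤ ((cfg (i + 1)).loc p).leTs → a ≤ time i)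
    (n : ℕ) {p : Proc f} (hp : p ∉ B) (hs : Sent (cfg n) p (.complaint T)) :
    ∃ i < n, a + timeout T ≤ time i := by
  induction n generalizing p with
  | zero => exact (h.not_sent_zero hs).elim
  | succ n ih =>
    have old : ∀ q ∉ B, Sent (cfg n) q (.complaint T) →
        ∃ i < n + 1, a + timeout T ≤ time i := fun q hq hs => by
      obtain ⟨i, hi, h'⟩ := ih hq hs
      exact ⟨i, hi.trans n.lt_succ_self, h'⟩
    rcases h.sent_cases hp hs with hs | ⟨e, s', o, q, htr, hq⟩
    · exact old p hp hs
    · obtain ⟨rfl, ⟨d, hd, hdn⟩ | ⟨k, hk, hmsg, hcard⟩⟩ := htr.complaint_out hq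
      · exact ⟨n, n.lt_succ_self, (h.deadline_le hT ha n hp rfl hd).trans hdn⟩
      -- An amplified complaint is never the first one: among `f+1` complaining processes a correct
      -- one sent its complaint earlier.
      · obtain ⟨q, hqB, hq⟩ := (((h.localInv n hp).heard_insert hk hmsg hcard).mono
          (h.received_sent n hp)).exists_correct hB
        exact old q hqB hq

/-- If timestamp `T` is entered at time `a` at the earliest, then it is left at time
`a + timeout T` at the earliest. -/
theorem IsExecution.leave_time (h : IsExecution timeout B p₀ gst δ cfg act time)
    (hB : B.card ≤ f) {T : ℕ} (hT : 2 ≤ T) {a : ℝ}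
    (ha : ∀ i, ∀ p ∉ B, T ≤ ((cfg (i + 1)).loc p).leTs → a ≤ time i)
    (i : ℕ) {p : Proc f} (hp : p ∉ B) (hs : T + 1 ≤ ((cfg (i + 1)).loc p).leTs) :
    a + timeout T ≤ time i := by
  obtain ⟨q, hq, hsent⟩ := ((h.complaint_heard (i + 1) hp (by omega)
    (show T < _ by omega)).weaken (by omega)).exists_correct hB
  obtain ⟨j, hj, h'⟩ := h.complaint_time hB hT ha (i + 1) hq hsent
  exact h'.trans (h.time_mono (by omega))

end Execution

/-! ### States between two moments of time. -/

/-- Step `j` is the last one at or before time `x`. -/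
def Boundary (time : ℕ → ℝ) (x : ℝ) (j : ℕ) : Prop := time j ≤ x ∧ x < time (j + 1)

/-- Every correct process has election timestamp at least `T`. -/
def Reached (B : Finset (Proc f)) (c : Config f V) (T : ℕ) : Prop :=
  ∀ p ∉ B, T ≤ (c.loc p).leTs

theorem Heard.mem_sent {c : Config f V} {a : ℕ} {x : Msg f V} {B : Finset (Proc f)}
    (hB : B.card ≤ f) (h : Heard c.sent (a + f) x) {R : Set (Packet f V)}
    (hR : ∀ q ∉ B, Sent c q x → ∃ k ∈ R, k.src = q ∧ k.msg = x) : Heard R a x := by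
  obtain ⟨Q, hQ, h⟩ := h
  refine ⟨Q \ B, ?_, fun q hq => ?_⟩
  · have := Finset.le_card_sdiff B Q
    omega
  · rw [Finset.mem_sdiff] at hq
    exact hR q hq.2 (h q hq.1)

section Execution

variable {timeout : ℕ → ℝ} {B : Finset (Proc f)} {p₀ : Proc f} {gst δ : ℝ}
  {cfg : ℕ → Config f V} {act : ℕ → Action f V} {time : ℕ → ℝ}

theorem IsExecution.exists_boundary (h : IsExecution timeout B p₀ gst δ cfg act time) {x : ℝ}
    (hx : 0 ≤ x) : ∃ j, Boundary time x j := by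
  classical
  have hex : ∃ n, x < time n := (h.time_unbounded.eventually_gt_atTop x).exists
  have hpos : Nat.find hex ≠ 0 := fun h0 => by
    have := Nat.find_spec hex
    rw [h0, h.time_zero] at this
    linarith
  obtain ⟨j, hj⟩ := Nat.exists_eq_succ_of_ne_zero hpos
  refine ⟨j, not_lt.1 (Nat.find_min hex (by omega)), ?_⟩
  have := Nat.find_spec hex
  rwa [hj] at this

theorem Boundary.le_index {x : ℝ} {j n : ℕ} (hj : Boundary time x j) (ht : Monotone time)
    (hn : time n ≤ x) : n ≤ j := by
  by_contra! hlt
  exact (hj.2.trans_le (ht hlt)).not_ge hn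

theorem Boundary.mono {x y : ℝ} {i j : ℕ} (hi : Boundary time y i) (hj : Boundary time x j)
    (ht : Monotone time) (hyx : y ≤ x) : i ≤ j :=
  hj.le_index ht (hi.1.trans hyx)

/-! At a boundary no handler is enabled. -/

section Boundary

variable {x : ℝ} {j : ℕ} {p : Proc f}

/-- Time strictly advances after step `j`, so urgency applies to configuration `j + 1`. -/
theorem IsExecution.not_enabled (h : IsExecution timeout B p₀ gst δ cfg act time)
    (hj : Boundary time x j) (hp : p ∉ B) {e : Event f V} {s' : LState f V} {o : Out f V}
    (hs : LocalStep timeout (time j) p ((cfg (j + 1)).loc p) e s' o) : ¬ e.Internal := fun he =>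
  h.urgent j (hj.1.trans_lt hj.2) p hp e he ⟨s', o, hs⟩

theorem IsExecution.lt_deadline (h : IsExecution timeout B p₀ gst δ cfg act time)
    (hj : Boundary time x j) (hp : p ∉ B) {d : ℝ}
    (hd : ((cfg (j + 1)).loc p).deadline = some d) : x < d := by
  have h1 : time j < d := by
    by_contra! hle
    exact h.not_enabled hj hp (.timeout d hd hle) trivial
  have := h.timer j p hp d hd
  rw [max_eq_right h1.le] at this
  exact hj.2.trans_le this

/-- Every received complaint of the current timestamp has been consumed, hence is counted in `leC`.
-/
theorem IsExecution.heard_complaint (h : IsExecution timeout B p₀ gst δ cfg act time)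
    (hj : Boundary time x j) (hp : p ∉ B) {a : ℕ}
    (ha : Heard ((cfg (j + 1)).loc p).received a (.complaint ((cfg (j + 1)).loc p).leTs)) :
    a ≤ ((cfg (j + 1)).loc p).leC.card := by
  obtain ⟨Q, hQ, ha⟩ := ha
  refine hQ.trans (Finset.card_le_card fun q hq => ?_)
  obtain ⟨k, hk, rfl, hmsg⟩ := ha q hq
  have hh : k ∈ ((cfg (j + 1)).loc p).handled := by
    by_contra hh
    exact h.not_enabled hj hp (.complaint k ⟨hk, hh⟩ hmsg) trivial
  exact ((h.localInv _ hp).handled_complaint k hh _ hmsg).2 rfl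

theorem IsExecution.leComplained_of_heard (h : IsExecution timeout B p₀ gst δ cfg act time)
    (hj : Boundary time x j) (hp : p ∉ B)
    (ha : Heard ((cfg (j + 1)).loc p).received (f + 1)
      (.complaint ((cfg (j + 1)).loc p).leTs)) : ((cfg (j + 1)).loc p).leComplained :=
  (h.localInv _ hp).amplified (h.heard_complaint hj hp ha)

/-- All of these would be counted, but `leC` is cleared as soon as it reaches `2f+1`. -/
theorem IsExecution.not_heard_complaint (h : IsExecution timeout B p₀ gst δ cfg act time)
    (hj : Boundary time x j) (hp : p ∉ B) :
    ¬ Heard ((cfg (j + 1)).loc p).received (2 * f + 1)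
      (.complaint ((cfg (j + 1)).loc p).leTs) := fun ha => by
  have := h.heard_complaint hj hp ha
  have := (h.localInv (j + 1) hp).leC_card
  omega

theorem IsExecution.contrib_mem_q (h : IsExecution timeout B p₀ gst δ cfg act time)
    (hj : Boundary time x j) (hp : p ∉ B) (hlead : p = ((cfg (j + 1)).loc p).leader)
    {k : Packet f V} {m : V} (hk : k ∈ ((cfg (j + 1)).loc p).received)
    (hmsg : k.msg = .signed (.contrib m ((cfg (j + 1)).loc p).ts)) :
    k.src ∈ ((cfg (j + 1)).loc p).q := by
  have hh : k ∈ ((cfg (j + 1)).loc p).handled := by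
    by_contra hh
    exact h.not_enabled hj hp (.contribution k m ⟨hk, hh⟩ hmsg hlead) trivial
  exact ((h.localInv _ hp).handled_contrib k hh _ _ hmsg).2 rfl

theorem IsExecution.valid_handled (h : IsExecution timeout B p₀ gst δ cfg act time)
    (hj : Boundary time x j) (hp : p ∉ B) (hlead : p = ((cfg (j + 1)).loc p).leader)
    {k : Packet f V} {M : Finset V} {sigs : Finset (Sig f V)} {t : ℕ}
    (hk : k ∈ ((cfg (j + 1)).loc p).received) (hmsg : k.msg = .valid M sigs t)
    (hatt : VoteCert M sigs t) : k ∈ ((cfg (j + 1)).loc p).handled := by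
  by_contra hh
  exact h.not_enabled hj hp (.validSet k M sigs t ⟨hk, hh⟩ hmsg hlead hatt) trivial

theorem IsExecution.proposed_of_card (h : IsExecution timeout B p₀ gst δ cfg act time)
    (hj : Boundary time x j) (hp : p ∉ B) (hq : 2 * f + 1 ≤ ((cfg (j + 1)).loc p).q.card) :
    ((cfg (j + 1)).loc p).proposed := by
  by_contra hh
  exact h.not_enabled hj hp (.propose hq hh) trivial

theorem IsExecution.echoed_of_agg (h : IsExecution timeout B p₀ gst δ cfg act time)
    (hj : Boundary time x j) (hp : p ∉ B) {k : Packet f V} {M : Finset V}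
    {sigs : Finset (Sig f V)} (hk : k ∈ ((cfg (j + 1)).loc p).received)
    (hmsg : k.msg = .agg M sigs ((cfg (j + 1)).loc p).ts)
    (hsrc : k.src = ((cfg (j + 1)).loc p).leader)
    (hatt : Attests M sigs ((cfg (j + 1)).loc p).ts) : ((cfg (j + 1)).loc p).echoed := by
  by_contra hh
  by_cases hk' : k ∈ ((cfg (j + 1)).loc p).handled
  · exact hh (((h.localInv _ hp).handled_agg k hk' _ _ _ hmsg).2 rfl)
  · exact h.not_enabled hj hp (.aggregation k M sigs ⟨hk, hk'⟩ hmsg hsrc hh hatt) trivial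

theorem IsExecution.readied_of_echo (h : IsExecution timeout B p₀ gst δ cfg act time)
    (hj : Boundary time x j) (hp : p ∉ B) {M : Finset V}
    (hM : Heard ((cfg (j + 1)).loc p).received (2 * f + 1)
      (.signed (.echo M ((cfg (j + 1)).loc p).ts))) : ((cfg (j + 1)).loc p).readied := by
  by_contra hh
  exact h.not_enabled hj hp (.echoQuorum M (LState.heard_iff.2 hM) hh) trivial

theorem IsExecution.readied_of_ready (h : IsExecution timeout B p₀ gst δ cfg act time)
    (hj : Boundary time x j) (hp : p ∉ B) {M : Finset V}
    (hM : Heard ((cfg (j + 1)).loc p).received (f + 1)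
      (.signed (.ready M ((cfg (j + 1)).loc p).ts))) : ((cfg (j + 1)).loc p).readied := by
  by_contra hh
  exact h.not_enabled hj hp (.readyAmplify M (LState.heard_iff.2 hM) hh) trivial

theorem IsExecution.delivered_of_ready (h : IsExecution timeout B p₀ gst δ cfg act time)
    (hj : Boundary time x j) (hp : p ∉ B) {M : Finset V}
    (hM : Heard ((cfg (j + 1)).loc p).received (2 * f + 1)
      (.signed (.ready M ((cfg (j + 1)).loc p).ts))) : ((cfg (j + 1)).loc p).delivered := by
  by_contra hh
  exact h.not_enabled hj hp (.deliver M (LState.heard_iff.2 hM) hh) trivial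

end Boundary

/-! ### Propagation of messages within one message delay. -/

section TwoBoundaries

variable {x y : ℝ} {i j : ℕ}

theorem IsExecution.received_of_sent (h : IsExecution timeout B p₀ gst δ cfg act time)
    (hi : Boundary time y i) (hj : Boundary time x j) (hyx : y + δ ≤ x) (hx : gst + δ ≤ x)
    {k : Packet f V} (hk : k ∈ (cfg (i + 1)).sent) (hsrc : k.src ∉ B) (hdst : k.dst ∉ B) :
    k ∈ ((cfg (j + 1)).loc k.dst).received := by
  obtain ⟨n, hn, hnt⟩ := h.synchrony _ k hk hsrc hdst
  have hid : time k.id ≤ y := (h.time_mono (Nat.lt_succ_iff.1 (h.id_lt _ k hk))).trans hi.1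
  have hnx : time n ≤ x := by
    rcases max_cases (time k.id) gst with ⟨h', -⟩ | ⟨h', -⟩ <;> rw [h'] at hnt <;> linarith
  refine (h.loc_mono hdst (Nat.succ_le_succ (hj.le_index h.time_mono hnx))).2.1 ?_
  have hs := h.step n
  rw [hn] at hs
  generalize cfg (n + 1) = c at hs
  cases hs with
  | run _ _ s' o hp hnet hstep =>
    cases hstep
    simp

theorem IsExecution.received_of_public (h : IsExecution timeout B p₀ gst δ cfg act time)
    (hi : Boundary time y i) (hj : Boundary time x j) (hyx : y + δ ≤ x) (hx : gst + δ ≤ x)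
    {z : Msg f V} (hz : z.Public) {p q : Proc f} (hp : p ∉ B) (hq : q ∉ B)
    (hs : Sent (cfg (i + 1)) p z) :
    ∃ k ∈ ((cfg (j + 1)).loc q).received, k.src = p ∧ k.msg = z := by
  obtain ⟨k, hk, rfl, rfl⟩ := hs
  exact ⟨{ k with dst := q }, h.received_of_sent hi hj hyx hx (h.public_sent _ hk hp hz q) hp hq,
    rfl, rfl⟩

theorem IsExecution.heard_of_sent (h : IsExecution timeout B p₀ gst δ cfg act time)
    (hB : B.card ≤ f) (hi : Boundary time y i) (hj : Boundary time x j) (hyx : y + δ ≤ x)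
    (hx : gst + δ ≤ x) {z : Msg f V} (hz : z.Public) {q : Proc f} (hq : q ∉ B)
    (hs : ∀ p ∉ B, Sent (cfg (i + 1)) p z) :
    Heard ((cfg (j + 1)).loc q).received (2 * f + 1) z :=
  ⟨Bᶜ, two_mul_lt_card_compl hB, fun p hp =>
    have hp := Finset.mem_compl.1 hp
    h.received_of_public hi hj hyx hx hz hp hq (hs p hp)⟩

/-- At least `f+1` of the `2f+1` senders are correct, and what they sent publicly reaches `q` too.
-/
theorem IsExecution.heard_of_heard (h : IsExecution timeout B p₀ gst δ cfg act time)
    (hB : B.card ≤ f) (hi : Boundary time y i) (hj : Boundary time x j) (hyx : y + δ ≤ x)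
    (hx : gst + δ ≤ x) {z : Msg f V} (hz : z.Public) {q : Proc f} (hq : q ∉ B)
    (hs : Heard (cfg (i + 1)).sent (2 * f + 1) z) :
    Heard ((cfg (j + 1)).loc q).received (f + 1) z :=
  Heard.mem_sent hB (hs.weaken (by omega)) fun _ hp hs =>
    h.received_of_public hi hj hyx hx hz hp hq hs

theorem IsExecution.reached_mono (h : IsExecution timeout B p₀ gst δ cfg act time) {T m n : ℕ}
    (hT : Reached B (cfg m) T) (hmn : m ≤ n) : Reached B (cfg n) T := fun p hp =>
  (hT p hp).trans (h.loc_mono hp hmn).1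

/-- If all correct processes have reached `T`, and one has reached `T + 1` a message delay ago, then
all reach `T + 1` within another message delay. -/
theorem IsExecution.reached_succ (h : IsExecution timeout B p₀ gst δ cfg act time)
    (hB : B.card ≤ f) {w : ℝ} {l T : ℕ} (hT : 1 ≤ T) (hl : Boundary time w l)
    (hi : Boundary time y i) (hj : Boundary time x j) (hδ : 0 < δ) (hwy : w + δ ≤ y)
    (hyx : y + δ ≤ x) (hy : gst + δ ≤ y) {p : Proc f} (hp : p ∉ B)
    (hpT : T + 1 ≤ ((cfg (l + 1)).loc p).leTs) (hr : Reached B (cfg (i + 1)) T) :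
    Reached B (cfg (j + 1)) (T + 1) := by
  -- The first delay: the `f+1` correct complaints behind the move of `p` make everybody complain.
  -- The second delay delivers these complaints to all.
  have hsent : ∀ q ∉ B, Sent (cfg (i + 1)) q (.complaint T) := fun q hq => by
    rcases (hr q hq).lt_or_eq with hlt | heq
    · exact (h.outInv _ hq).complained_before T hT hlt
    · have := h.heard_of_heard hB hl hi hwy hy (z := .complaint T) trivial hq
        (h.complaint_heard _ hp hT hpT)
      rw [heq] at this ⊢
      exact (h.outInv _ hq).complained (h.leComplained_of_heard hi hq this)
  intro q hq
  have hle := h.reached_mono hr (Nat.succ_le_succ (hi.mono hj h.time_mono (by linarith))) q hq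
  rcases hle.lt_or_eq with hlt | heq
  · exact hlt
  · have := h.heard_of_sent hB hi hj hyx (by linarith) (z := .complaint T) trivial hq hsent
    rw [heq] at this
    exact (h.not_heard_complaint hj hq this).elim

/-- If all correct processes are ready under timestamp `t`, then they deliver a message delay
later, provided that they still have this timestamp. -/
theorem IsExecution.delivered_of_readied (h : IsExecution timeout B p₀ gst δ cfg act time)
    (hB : B.card ≤ f) (hi : Boundary time y i) (hj : Boundary time x j) (hyx : y + δ ≤ x)
    (hx : gst + δ ≤ x) {t : ℕ} (hr : ∀ q ∉ B, ((cfg (i + 1)).loc q).readied)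
    (hti : ∀ q ∉ B, ((cfg (i + 1)).loc q).ts = t) (htj : ∀ q ∉ B, ((cfg (j + 1)).loc q).ts = t)
    {p : Proc f} (hp : p ∉ B) : ((cfg (j + 1)).loc p).delivered := by
  obtain ⟨M, hM⟩ := (h.outInv _ hp).readied (hr p hp)
  rw [hti p hp] at hM
  have hs : ∀ q ∉ B, Sent (cfg (i + 1)) q (.signed (.ready M t)) := fun q hq => by
    obtain ⟨M', hM'⟩ := (h.outInv _ hq).readied (hr q hq)
    rw [hti q hq] at hM'
    rwa [h.ready_unique hB _ hp hq hM hM']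
  have := h.heard_of_sent hB hi hj hyx hx (z := .signed (.ready M t)) trivial hp hs
  rw [← htj p hp] at this
  exact h.delivered_of_ready hj hp this

end TwoBoundaries

/-- If one correct process has reached `T`, then all reach it. -/
theorem IsExecution.exists_reached (h : IsExecution timeout B p₀ gst δ cfg act time)
    (hB : B.card ≤ f) (hδ : 0 < δ) (T : ℕ)
    (hT : ∃ n, ∃ p ∉ B, T ≤ ((cfg n).loc p).leTs) : ∃ n, Reached B (cfg n) T := by
  induction T with
  | zero => exact ⟨0, fun _ _ => Nat.zero_le _⟩
  | succ T ih =>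
    obtain ⟨n, p, hp, hn⟩ := hT
    rcases T.eq_zero_or_pos with rfl | hpos
    · exact ⟨0, fun q hq => (h.localInv 0 hq).leTs_pos⟩
    obtain ⟨m, hm⟩ := ih ⟨n, p, hp, by omega⟩
    have h0 : ∀ k, 0 ≤ time k := fun k => h.time_zero ▸ h.time_mono k.zero_le
    obtain ⟨l, hl⟩ := h.exists_boundary (h0 n)
    -- Late enough for the complaints about `T` to have arrived after stabilization and for all
    -- correct processes to have reached `T`.
    set y := max (max (time n) gst + δ) (time m) with hy
    have hy1 : max (time n) gst + δ ≤ y := le_max_left _ _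
    have hy2 : time m ≤ y := le_max_right _ _
    have := le_max_left (time n) gst
    have := le_max_right (time n) gst
    obtain ⟨i, hi⟩ := h.exists_boundary ((h0 m).trans hy2)
    obtain ⟨j, hj⟩ := h.exists_boundary (x := y + δ) (by linarith [h0 m])
    exact ⟨j + 1, h.reached_succ hB hpos hl hi hj hδ (by linarith) le_rfl (by linarith) hp
      (hn.trans (h.loc_mono hp ((hl.le_index h.time_mono le_rfl).trans (Nat.le_succ _))).1)
      (h.reached_mono hm ((hi.le_index h.time_mono hy2).trans (Nat.le_succ _)))⟩

end Execution

/-! ### The case of finitely many leader changes. -/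

section Execution

variable {timeout : ℕ → ℝ} {B : Finset (Proc f)} {p₀ : Proc f} {gst δ : ℝ}
  {cfg : ℕ → Config f V} {act : ℕ → Action f V} {time : ℕ → ℝ}

theorem IsExecution.time_nonneg (h : IsExecution timeout B p₀ gst δ cfg act time) (n : ℕ) :
    0 ≤ time n := h.time_zero ▸ h.time_mono n.zero_le

theorem IsExecution.exists_broadcast (h : IsExecution timeout B p₀ gst δ cfg act time)
    (hb : ∀ p ∉ B, Broadcasts act p) : ∃ n, ∀ p ∉ B, ((cfg n).loc p).myM ≠ none := by
  have hone : ∀ p, ∃ n, p ∉ B → ((cfg n).loc p).myM ≠ none := fun p => by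
    by_cases hp : p ∈ B
    · exact ⟨0, fun hp' => (hp' hp).elim⟩
    obtain ⟨n, m, hn⟩ := hb p hp
    refine ⟨n + 1, fun _ => ?_⟩
    have hs := h.step n
    rw [hn] at hs
    generalize cfg (n + 1) = c at hs
    cases hs with
    | run _ _ s' o hp hnet hstep =>
      cases hstep
      simp
  choose N hN using hone
  exact ⟨Finset.univ.sup N, fun p hp =>
    (h.loc_mono hp (Finset.le_sup (Finset.mem_univ p))).2.2 (hN p hp)⟩

/-- If the leader changes only finitely often, then all correct processes deliver. -/
theorem IsExecution.delivers_of_bounded (h : IsExecution timeout B p₀ gst δ cfg act time)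
    (hB : B.card ≤ f) (hδ : 0 < δ) (hb : ∀ p ∉ B, Broadcasts act p) {T n₀ : ℕ}
    (hmax : ∀ n, ∀ p ∉ B, ((cfg n).loc p).leTs ≤ T) (hr : Reached B (cfg n₀) T)
    {p : Proc f} (hp : p ∉ B) : Delivers act p := by
  obtain ⟨n₁, hn₁⟩ := h.exists_broadcast hb
  set N := max n₀ n₁
  have hT : ∀ n ≥ N, ∀ q ∉ B, ((cfg n).loc q).leTs = T := fun n hn q hq =>
    le_antisymm (hmax n q hq) (h.reached_mono hr ((le_max_left _ _).trans hn) q hq)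
  have hm : ∀ n ≥ N, ∀ q ∉ B, ((cfg n).loc q).myM ≠ none := fun n hn q hq =>
    (h.loc_mono hq ((le_max_right _ _).trans hn)).2.2 (hn₁ q hq)
  have hts : ∀ n ≥ N, ∀ q ∉ B, ((cfg n).loc q).ts = if T = 1 then 0 else T := fun n hn q hq => by
    rw [(h.localInv n hq).ts_eq, hT n hn q hq]
  -- After `N` there are neither broadcasts nor leader changes at correct processes, the only events
  -- that set a timer.
  have hdl : ∀ n ≥ N, ∀ q ∉ B, ((cfg n).loc q).deadline = none ∨
      ((cfg n).loc q).deadline = ((cfg N).loc q).deadline := fun n hn q hq => by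
    induction n, hn using Nat.le_induction with
    | base => exact .inr rfl
    | succ n hn ih =>
      rcases h.step_cases n hq with ⟨hloc, -⟩ | ⟨e, s', o, -, hloc, htr, -⟩
      · rwa [hloc]
      · have hT' := hT (n + 1) (hn.trans n.le_succ) q hq
        rw [hloc] at hT' ⊢
        cases htr with
        | broadcast m hm' => exact (hm n hn q hq hm').elim
        | change k o _ _ _ _ =>
          have := hT n hn q hq
          dsimp only at hT'
          omega
        | deliver M _ _ => exact .inl rfl
        | timeoutSilent d _ _ _ => exact .inl rfl
        | timeoutComplain d _ _ _ => exact .inl rfl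
        | _ => exact ih
  -- The default `0` is irrelevant: the bound is used only for timers that are running.
  obtain ⟨D, hD⟩ :=
    (Set.finite_range fun q => (((cfg N).loc q).deadline).getD 0).bddAbove
  set x := max D (time N)
  have hx0 : 0 ≤ x := (h.time_nonneg N).trans (le_max_right _ _)
  obtain ⟨i, hi⟩ := h.exists_boundary hx0
  have hNi : N ≤ i := hi.le_index h.time_mono (le_max_right _ _)
  set y := max x gst + δ with hy
  have hxy : x + δ ≤ y := by linarith [le_max_left x gst]
  have hgy : gst + δ ≤ y := by linarith [le_max_right x gst]
  obtain ⟨j, hj⟩ := h.exists_boundary (x := y) (by linarith)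
  have hij := hi.mono hj h.time_mono (by linarith)
  have hnone : ∀ q ∉ B, ((cfg (i + 1)).loc q).deadline = none := fun q hq => by
    rcases hdl (i + 1) (by omega) q hq with hd | hd
    · exact hd
    · cases hd' : ((cfg (i + 1)).loc q).deadline with
      | none => rfl
      | some d =>
        have h1 := h.lt_deadline hi hq hd'
        have h2 : d ≤ D := hD ⟨q, by simp [← hd, hd']⟩
        linarith [le_max_left D (time N)]
  have hheard : ∃ q ∉ B, ∃ M, Heard ((cfg (i + 1)).loc q).received (2 * f + 1)
      (.signed (.ready M ((cfg (i + 1)).loc q).ts)) := by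
    -- Otherwise every correct process turned its timer off by complaining, and these complaints
    -- would force a further leader change.
    by_contra! hno
    have hc : ∀ q ∉ B, Sent (cfg (i + 1)) q (.complaint T) := fun q hq => by
      have := ((h.localInv (i + 1) hq).deadline_none (hnone q hq)).resolve_right
        fun ⟨M, hM⟩ => hno q hq M hM
      rw [← hT (i + 1) (by omega) q hq]
      exact (h.outInv _ hq).complained this
    have := h.heard_of_sent hB hi hj hxy hgy (z := .complaint T) trivial hp hc
    rw [← hT (j + 1) (by omega) p hp] at this
    exact h.not_heard_complaint hj hp this
  obtain ⟨q, hq, M, hM⟩ := hheard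
  have hready : ∀ r ∉ B, ((cfg (j + 1)).loc r).readied := fun r hr => by
    have := h.heard_of_heard hB hi hj hxy hgy (z := .signed (.ready M _)) trivial hr
      (hM.mono (h.received_sent _ hq))
    rw [hts _ (by omega) q hq, ← hts (j + 1) (by omega) r hr] at this
    exact h.readied_of_ready hj hr this
  obtain ⟨l, hl⟩ := h.exists_boundary (x := y + δ) (by linarith)
  have hjl := hj.mono hl h.time_mono (by linarith)
  exact h.delivers hp (h.delivered_of_readied hB hj hl le_rfl (by linarith) hready
    (hts _ (by omega)) (hts _ (by omega)) hp)

/-! ### A timestamp with a correct leader. -/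

/-- A valid set that is sent to the leader of timestamp `T` is not consumed before this process
enters `T`, provided that it does not lead when it can arrive before; afterwards the leader counts
its sender. -/
theorem IsExecution.mem_q_of_handled (h : IsExecution timeout B p₀ gst δ cfg act time) {T : ℕ}
    {p : Proc f} (hp : p ∉ B) {k : Packet f V} {M : Finset V} {sigs : Finset (Sig f V)} {t : ℕ}
    (hmsg : k.msg = .valid M sigs t)
    (hlead : ∀ n, k ∈ (cfg n).sent → ((cfg n).loc p).leTs < T → p ≠ ((cfg n).loc p).leader)
    (n : ℕ) (hT : ((cfg n).loc p).leTs ≤ T) (hk : k ∈ ((cfg n).loc p).handled) :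
    ((cfg n).loc p).leTs = T ∧ k.src ∈ ((cfg n).loc p).q := by
  induction n with
  | zero => simp [h.init, LState.init] at hk
  | succ n ih =>
    rcases h.step_cases n hp with ⟨hloc, -⟩ | ⟨e, s', o, -, hloc, htr, -⟩
    · rw [hloc] at hT hk ⊢
      exact ih hT hk
    · rw [hloc] at hT hk ⊢
      cases htr with
      | contribution k' m hk' hmsg' _ =>
        obtain rfl | hk := hk
        · simp [hmsg] at hmsg'
        · exact ⟨(ih hT hk).1, Finset.mem_insert_of_mem (ih hT hk).2⟩
      | validSet k' M' sigs' t' hk' _ hl _ =>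
        obtain rfl | hk := hk
        · refine ⟨hT.antisymm (not_lt.1 fun hlt => ?_), Finset.mem_insert_self _ _⟩
          exact hlead n (h.received_sent n hp hk'.1) hlt hl
        · exact ⟨(ih hT hk).1, Finset.mem_insert_of_mem (ih hT hk).2⟩
      | aggregation k' M' sigs' hk' hmsg' _ _ =>
        obtain rfl | hk := hk
        · simp [hmsg] at hmsg'
        · exact ih hT hk
      | complaintSilent k' _ hmsg' _ _ =>
        obtain rfl | hk := hk
        · simp [hmsg] at hmsg'
        · exact ih hT hk
      | complaintAmplify k' _ hmsg' _ _ _ =>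
        obtain rfl | hk := hk
        · simp [hmsg] at hmsg'
        · exact ih hT hk
      | change k' o _ hmsg' _ _ =>
        obtain rfl | hk := hk
        · simp [hmsg] at hmsg'
        · have := ih ((Nat.le_succ _).trans hT) hk
          dsimp only at hT
          omega
      | _ => exact ih hT hk

/-- Suppose that timestamp `T` has a correct leader and a timeout above `6 δ`, that it is entered
first in step `i₀`, after the stabilization time and after all broadcasts, and that all correct
processes enter `T` within `2 δ`. Then all of them deliver. -/
theorem IsExecution.delivers_of_leader (h : IsExecution timeout B p₀ gst δ cfg act time)
    (hB : B.card ≤ f) (hδ : 0 < δ) {T i₀ : ℕ} (hT : 3 ≤ T)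
    (hleader : Fin.ofNat (3 * f + 1) T ∉ B) (htimeout : 6 * δ < timeout T)
    (hfirst : ∀ i, ∀ p ∉ B, T ≤ ((cfg (i + 1)).loc p).leTs → i₀ ≤ i)
    (hgst : gst ≤ time i₀) (hm : ∀ p ∉ B, ((cfg i₀).loc p).myM ≠ none)
    (hprev : Reached B (cfg i₀) (T - 1))
    (hr : ∀ j, Boundary time (time i₀ + 2 * δ) j → Reached B (cfg (j + 1)) T)
    {p : Proc f} (hp : p ∉ B) : Delivers act p := by
  set l : Proc f := Fin.ofNat (3 * f + 1) T with hl
  have h0 := h.time_nonneg i₀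
  obtain ⟨j₂, hj₂⟩ := h.exists_boundary (x := time i₀ + 2 * δ) (by linarith)
  obtain ⟨j₃, hj₃⟩ := h.exists_boundary (x := time i₀ + 3 * δ) (by linarith)
  obtain ⟨j₄, hj₄⟩ := h.exists_boundary (x := time i₀ + 4 * δ) (by linarith)
  obtain ⟨j₅, hj₅⟩ := h.exists_boundary (x := time i₀ + 5 * δ) (by linarith)
  obtain ⟨j₆, hj₆⟩ := h.exists_boundary (x := time i₀ + 6 * δ) (by linarith)
  -- During this window nobody leaves `T`, whose period exceeds `6δ` counted from the first entry.
  have hleTs : ∀ {x j}, Boundary time x j → time i₀ + 2 * δ ≤ x → x ≤ time i₀ + 6 * δ →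
      ∀ q ∉ B, ((cfg (j + 1)).loc q).leTs = T := fun {x j} hj h1 h2 q hq => by
    refine le_antisymm (not_lt.1 fun hlt => ?_) ?_
    · have := h.leave_time hB (by omega) (fun i q hq hi => h.time_mono (hfirst i q hq hi))
        j hq hlt
      linarith [hj.1]
    · exact h.reached_mono (hr j₂ hj₂)
        (Nat.succ_le_succ (hj₂.mono hj h.time_mono h1)) q hq
  have hts : ∀ {x j}, Boundary time x j → time i₀ + 2 * δ ≤ x → x ≤ time i₀ + 6 * δ →
      ∀ q ∉ B, ((cfg (j + 1)).loc q).ts = T := fun {x j} hj h1 h2 q hq => by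
    rw [(h.localInv _ hq).ts_eq, hleTs hj h1 h2 q hq, if_neg (by omega)]
  have hlead : ∀ {x j}, Boundary time x j → time i₀ + 2 * δ ≤ x → x ≤ time i₀ + 6 * δ →
      ∀ q ∉ B, ((cfg (j + 1)).loc q).leader = l := fun {x j} hj h1 h2 q hq => by
    have := hleTs hj h1 h2 q hq
    rw [(h.localInv _ hq).leader_eq (by omega), this]
  -- The leader hears from all correct processes.
  have hq : ∀ q ∉ B, q ∈ ((cfg (j₃ + 1)).loc l).q := fun q hq => by
    obtain ⟨i, hi, hiT, hjoin⟩ := h.entry hq (by omega) (j₂ + 1)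
      (hleTs hj₂ le_rfl (by linarith) q hq)
    have hi₀ := hfirst i q hq hiT.ge
    obtain ⟨k, hk, hid, rfl, hdst, hk'⟩ :=
      hjoin.resolve_left ((h.loc_mono hq hi₀).2.2 (hm q hq))
    have hrec := h.received_of_sent hj₂ hj₃ (by linarith) (by linarith) hk hq
      (by rwa [hdst])
    rw [hdst] at hrec
    have hlead₃ := (hlead hj₃ (by linarith) (by linarith) l hleader).symm
    obtain ⟨m, hmsg⟩ | ⟨M, sigs, t, hmsg, hc⟩ := hk'
    · rw [← hts hj₃ (by linarith) (by linarith) l hleader] at hmsg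
      exact h.contrib_mem_q hj₃ hleader hlead₃ hrec hmsg
    · have hh := h.valid_handled hj₃ hleader hlead₃ hrec hmsg hc
      refine (h.mem_q_of_handled hleader hmsg (fun n hn hlt hcon => ?_) (j₃ + 1)
        (hleTs hj₃ (by linarith) (by linarith) l hleader).le hh).2
      have hin := h.id_lt n k hn
      rw [hid] at hin
      have hge := h.reached_mono hprev (show i₀ ≤ n by omega) l hleader
      rw [(h.localInv n hleader).leader_eq (by omega),
        show ((cfg n).loc l).leTs = T - 1 by omega] at hcon
      have hmod := congrArg Fin.val hcon
      rw [hl] at hmod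
      simp only [Fin.val_ofNat] at hmod
      -- For `f = 0` consecutive leaders coincide, but then the sender is the leader itself and has
      -- already entered `T`.
      rcases f.eq_zero_or_pos with rfl | hf
      · have := (h.loc_mono hq (show i + 1 ≤ n by omega)).1
        have hsub : k.src = l := Subsingleton.elim (α := Fin 1) _ _
        rw [hsub] at this hiT
        omega
      · have := Nat.sub_mod_eq_zero_of_mod_eq hmod
        rw [show T - (T - 1) = 1 by omega, Nat.mod_eq_of_lt (by omega)] at this
        omega
  have hprop := h.proposed_of_card hj₃ hleader
    ((two_mul_lt_card_compl hB).trans (Finset.card_le_card fun q hqB =>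
      hq q (Finset.mem_compl.1 hqB)))
  obtain ⟨M, sigs, hatt, hagg⟩ := (h.outInv _ hleader).proposed hprop
  rw [hts hj₃ (by linarith) (by linarith) l hleader] at hatt hagg
  -- All correct processes echo its aggregation.
  have hecho : ∀ q ∉ B, Sent (cfg (j₄ + 1)) q (.signed (.echo M T)) := fun q hq => by
    have hts₄ := hts hj₄ (by linarith) (by linarith) q hq
    obtain ⟨k, hk, hsrc, hmsg⟩ := h.received_of_public hj₃ hj₄ (by linarith) (by linarith)
      (z := .agg M sigs T) trivial hleader hq hagg
    rw [← hts₄] at hmsg hatt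
    obtain ⟨M', hM'⟩ := (h.outInv _ hq).echoed (h.echoed_of_agg hj₄ hq hk hmsg
      (by rw [hsrc, hlead hj₄ (by linarith) (by linarith) q hq]) hatt)
    rw [hts₄] at hM'
    -- The echo of `q` need not come from the packet `k`, but it repeats some aggregation of the
    -- leader, and these agree.
    obtain ⟨sigs', hagg'⟩ := h.echo_agg _ hq (by omega) hM'
    have hj₃₄ := hj₃.mono hj₄ h.time_mono (by linarith)
    rwa [(h.outInv _ hleader).agg_unique _ _ _ _ _ (h.sent_mono (by omega) hagg) hagg']
  have hready : ∀ q ∉ B, ((cfg (j₅ + 1)).loc q).readied := fun q hq => by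
    have := h.heard_of_sent hB hj₄ hj₅ (by linarith) (by linarith)
      (z := .signed (.echo M T)) trivial hq hecho
    rw [← hts hj₅ (by linarith) (by linarith) q hq] at this
    exact h.readied_of_echo hj₅ hq this
  exact h.delivers hp (h.delivered_of_readied hB hj₅ hj₆ (by linarith) (by linarith) hready
    (hts hj₅ (by linarith) (by linarith)) (hts hj₆ (by linarith) le_rfl) hp)

/-! ### The case of infinitely many leader changes. -/

/-- If the leader changes infinitely often, then all correct processes deliver. -/
theorem IsExecution.delivers_of_unbounded (h : IsExecution timeout B p₀ gst δ cfg act time)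
    (hB : B.card ≤ f) (hδ : 0 < δ) (htimeout : ∀ᶠ t in Filter.atTop, 6 * δ < timeout t)
    (hb : ∀ p ∉ B, Broadcasts act p) (hun : ∀ T, ∃ n, ∃ p ∉ B, T ≤ ((cfg n).loc p).leTs)
    {p : Proc f} (hp : p ∉ B) : Delivers act p := by
  classical
  have hex : ∀ T, ∃ i, ∃ q ∉ B, T ≤ ((cfg (i + 1)).loc q).leTs := fun T => by
    obtain ⟨n, q, hq, hn⟩ := hun T
    exact ⟨n, q, hq, hn.trans (h.loc_mono hq n.le_succ).1⟩
  -- `F T` is the step in which a correct process first reaches `T`.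
  obtain ⟨F, hF, hmin⟩ : ∃ F : ℕ → ℕ, (∀ T, ∃ q ∉ B, T ≤ ((cfg (F T + 1)).loc q).leTs) ∧
      ∀ T i, ∀ q ∉ B, T ≤ ((cfg (i + 1)).loc q).leTs → F T ≤ i :=
    ⟨fun T => Nat.find (hex T), fun T => Nat.find_spec (hex T),
      fun T i q hq hi => Nat.find_min' (hex T) ⟨q, hq, hi⟩⟩
  obtain ⟨T₁, hT₁⟩ := Filter.eventually_atTop.1 htimeout
  set T₀ := max T₁ 2
  have hT₀ : 2 ≤ T₀ := le_max_right _ _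
  have hgap : ∀ T ≥ T₀, time (F T) + 6 * δ ≤ time (F (T + 1)) := fun T hT => by
    obtain ⟨q, hq, hqT⟩ := hF (T + 1)
    have := h.leave_time hB (hT₀.trans hT)
      (fun i q hq hi => h.time_mono (hmin T i q hq hi)) _ hq hqT
    linarith [hT₁ T ((le_max_left _ _).trans hT)]
  have hlin : ∀ k : ℕ, time (F T₀) + 6 * δ * k ≤ time (F (T₀ + k)) := fun k => by
    induction k with
    | zero => simp
    | succ k ih =>
      have := hgap (T₀ + k) (Nat.le_add_right _ _)
      push_cast
      rw [← Nat.add_assoc]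
      linarith
  have hlarge : ∀ y : ℝ, ∃ K, ∀ k ≥ K, y < time (F (T₀ + k)) := fun y => by
    obtain ⟨K, hK⟩ := exists_nat_gt (y / (6 * δ))
    rw [div_lt_iff₀ (by positivity)] at hK
    refine ⟨K, fun k hk => ?_⟩
    have h1 : (K : ℝ) * (6 * δ) ≤ k * (6 * δ) := by gcongr
    linarith [hlin k, h.time_nonneg (F T₀)]
  obtain ⟨n₁, hn₁⟩ := h.exists_broadcast hb
  obtain ⟨K, hK⟩ := hlarge (max (time n₁) gst)
  obtain ⟨n₀, hn₀⟩ := h.exists_reached hB hδ (T₀ + K) (hun _)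
  have hgst : ∀ k, gst ≤ time (F (T₀ + (K + k))) := fun k =>
    (le_max_right _ _).trans (hK _ (Nat.le_add_right _ _)).le
  -- All correct processes reach a timestamp within a lag that decreases by `5 δ` each time.
  have hlag : ∀ k : ℕ, ∀ j,
      Boundary time (time (F (T₀ + (K + k))) + max (2 * δ) (time n₀ - 5 * δ * k)) j →
      Reached B (cfg (j + 1)) (T₀ + (K + k)) := fun k => by
    induction k with
    | zero =>
      -- Times are nonnegative, so at the start a lag of `time n₀` suffices.
      intro j hj
      refine h.reached_mono hn₀ ((hj.le_index h.time_mono ?_).trans j.le_succ)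
      have := le_max_right (2 * δ) (time n₀ - 5 * δ * (0 : ℕ))
      rw [Nat.cast_zero, mul_zero] at this ⊢
      linarith [h.time_nonneg (F (T₀ + (K + 0)))]
    | succ k ih =>
      intro j hj
      rw [← Nat.add_assoc, ← Nat.add_assoc] at hj ⊢
      have hg := hgap (T₀ + (K + k)) (Nat.le_add_right _ _)
      rw [← Nat.add_assoc] at hg ih
      have hgst' := hgst (k + 1)
      rw [← Nat.add_assoc, ← Nat.add_assoc] at hgst'
      set w := time (F (T₀ + K + k + 1))
      set L := max (2 * δ) (time n₀ - 5 * δ * (k + 1 : ℕ)) with hL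
      have hL1 : 2 * δ ≤ L := le_max_left _ _
      have hL2 : max (2 * δ) (time n₀ - 5 * δ * k) ≤ L + 5 * δ := by
        refine max_le (by linarith) ?_
        have := le_max_right (2 * δ) (time n₀ - 5 * δ * (k + 1 : ℕ))
        rw [← hL] at this
        push_cast at this
        linarith
      have hw : 0 ≤ w := h.time_nonneg _
      obtain ⟨l, hl⟩ := h.exists_boundary hw
      obtain ⟨m, hm⟩ := h.exists_boundary
        (x := time (F (T₀ + K + k)) + max (2 * δ) (time n₀ - 5 * δ * k))
        (add_nonneg (h.time_nonneg _) (le_max_of_le_left (by linarith)))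
      -- The last `δ` is the second delay in `reached_succ`, and `2δ ≤ L` leaves room for the first.
      -- The gap of `6δ` less this `δ` is the gain of `5δ`.
      obtain ⟨i, hi⟩ := h.exists_boundary (x := w + L - δ) (by linarith)
      obtain ⟨q, hq, hqT⟩ := hF (T₀ + K + k + 1)
      exact h.reached_succ hB (by omega) hl hi hj hδ (by linarith) (by linarith) (by linarith) hq
        (hqT.trans (h.loc_mono hq (Nat.succ_le_succ (hl.le_index h.time_mono le_rfl))).1)
        (h.reached_mono (ih m hm) (Nat.succ_le_succ (hm.mono hi h.time_mono (by linarith))))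
  obtain ⟨K', hK'⟩ := exists_nat_gt (time n₀ / (5 * δ))
  rw [div_lt_iff₀ (by positivity)] at hK'
  have hlag' : ∀ k ≥ K', ∀ j, Boundary time (time (F (T₀ + (K + k))) + 2 * δ) j →
      Reached B (cfg (j + 1)) (T₀ + (K + k)) := fun k hk j hj => by
    refine hlag k j ?_
    have h1 : (K' : ℝ) * (5 * δ) ≤ k * (5 * δ) := by gcongr
    rwa [max_eq_left (by linarith)]
  -- The process `p` itself leads a sufficiently late timestamp.
  obtain ⟨k, hk⟩ : ∃ k, (3 * f + 1) * (T₀ + K + K' + 1) + p.val = T₀ + (K + (K' + k)) + 1 := by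
    have : T₀ + K + K' + 1 ≤ (3 * f + 1) * (T₀ + K + K' + 1) :=
      Nat.le_mul_of_pos_left _ (by omega)
    obtain ⟨k, hk⟩ := Nat.exists_eq_add_of_le (this.trans (Nat.le_add_right _ p.val))
    exact ⟨k, by rw [hk]; omega⟩
  have hpl : Fin.ofNat (3 * f + 1) (T₀ + (K + (K' + k)) + 1) = p := by
    rw [← hk]
    apply Fin.ext
    simp [Nat.add_mod, Nat.mod_eq_of_lt p.isLt]
  have hg := hgap (T₀ + (K + (K' + k))) (Nat.le_add_right _ _)
  refine h.delivers_of_leader hB hδ (T := T₀ + (K + (K' + k)) + 1) (by omega) (by rwa [hpl])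
    (hT₁ _ (by omega)) (hmin _) (hgst (K' + k + 1)) (fun q hq => ?_) ?_
    (hlag' (K' + k + 1) (by omega)) hp
  · refine (h.loc_mono hq (not_lt.1 fun hlt => ?_)).2.2 (hn₁ q hq)
    have h1 := hK (K + (K' + k + 1)) (Nat.le_add_right _ _)
    exact (((le_max_left _ _).trans_lt h1).trans_le (h.time_mono hlt.le)).false
  · have := h.time_nonneg (F (T₀ + (K + (K' + k))))
    obtain ⟨j, hj⟩ := h.exists_boundary
      (x := time (F (T₀ + (K + (K' + k)))) + 2 * δ) (by linarith)
    refine h.reached_mono (hlag' _ (Nat.le_add_right _ _) j hj) (Nat.succ_le_of_lt ?_)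
    by_contra! hle
    linarith [h.time_mono hle, hj.1]

end Execution

end BRD

theorem mainTheorem5 {f : ℕ} {V : Type*} (B : Finset (BRD.Proc f)) (hB : B.card ≤ f)
    (p₀ : BRD.Proc f) (gst δ : ℝ) (hδ : 0 < δ)
    (timeout : ℕ → ℝ) (htimeout_pos : ∀ t, 0 < timeout t)
    (htimeout : ∀ᶠ t in Filter.atTop, 6 * δ < timeout t)
    (cfg : ℕ → BRD.Config f V) (act : ℕ → BRD.Action f V) (time : ℕ → ℝ)
    (hexec : BRD.IsExecution timeout B p₀ gst δ cfg act time)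
    (hbroadcast : ∀ p ∉ B, BRD.Broadcasts act p) :
    ∀ p ∉ B, BRD.Delivers act p := by
  classical
  intro p hp
  by_cases hun : ∀ T, ∃ n, ∃ p ∉ B, T ≤ ((cfg n).loc p).leTs
  · exact hexec.delivers_of_unbounded hB hδ htimeout hbroadcast hun hp
  push Not at hun
  -- Timestamp `0` is trivially reached by `p`, so the least unreached timestamp has a predecessor,
  -- which is the maximum.
  have hpos : Nat.find hun ≠ 0 := fun h0 => by
    have := Nat.find_spec hun 0 p hp
    omega
  obtain ⟨T, hT⟩ := Nat.exists_eq_succ_of_ne_zero hpos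
  have hmax := Nat.find_spec hun
  have hreach := Nat.find_min hun (show T < _ by omega)
  push Not at hreach
  obtain ⟨n, hn⟩ := hexec.exists_reached hB hδ T hreach
  refine hexec.delivers_of_bounded hB hδ hbroadcast (fun n q hq => ?_) hn hp
  have := hmax n q hq
  omega
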